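/- Let $\mathbb S$ be a measurable space whose points are separated by countably many measurable sets (for instance a standard Borel space), let $G_0$ be a non-atomic probability measure on $\mathbb S$, let $\theta>0$ and $J\ge 1$. Let $P\sim\mathrm{DP}(\theta,G_0)$ be a Dirichlet process, i.e. a random probability measure on $\mathbb S$ such that $(P(A_1),\dots,P(A_k))$ has the Dirichlet distribution with parameters $(\theta G_0(A_1),\dots,\theta G_0(A_k))$ for every finite measurable partition $(A_1,\dots,A_k)$ of $\mathbb S$. For a measurable hash function $h:\mathbb S\to\{1,\dots,J\}$ write $\mathbb S_j=\{s: h(s)=j\}$. For a probability measure $p$ on $\mathbb S$ and $X_1,\dots,X_{n+1}$ i.i.d. from $p$ let $C_i=\#\{m\le n: h(X_m)=i\}$ be the sketch of the sample $(X_1,\dots,X_n)$, let $f_{X_{n+1}}=\#\{m\le n: X_m=X_{n+1}\}$, and for $\mathbf c=(c_1,\dots,c_J)\in\mathbb N_0^J$ with $\sum_i c_i=n$ put $$\pi_j(r;p)=\Pr[f_{X_{n+1}}=r\mid \mathbf C_J=\mathbf c,\ h(X_{n+1})=j],\qquad \varepsilon_f(p)=\mathbb E[f_{X_{n+1}}\mid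 \mathbf C_J=\mathbf c,\ h(X_{n+1})=j].$$ Let $h$ be a random hash function, drawn independently of $P$ from a strongly universal family, that is, $\Pr[h(x)=i,\,h(y)=j]=J^{-2}$ for all $x\neq y$ in $\mathbb S$ and all $i,j$; the family is also independent of draws from $G_0$ in the sense that, for each $j$, the probability that two independent draws from $G_0$ are both hashed to $j$ may be computed by averaging over $h$ and over the draws in either order. Then almost every $h$ satisfies $G_0(\mathbb S_j)=1/J$ for all $j$. For every measurable $h$ with this property (hence for almost every $h$), and for every $j$: 1. Let $P_j=P(\,\cdot\cap\mathbb S_j)/P(\mathbb S_j)$, and let $V_j=P_j(\{X\})$ be the mass that $P_j$ gives to a symbol $X$ which is drawn from $P_j$ given $P$. Then $V_j\sim\mathrm{Beta}(1,\theta/J)$. 2. For all $n$, all $\mathbf c$ with $\sum_i c_i=n$ and all $0\le r\le c_j$, the smoothed probability $\pi_j(r):=\mathbb E_{P\sim \mathrm{DP}(\theta,G_0)}[\pi_j(r;P)]$ is the mixture of Binomial probabilities with mixing variable $V_j$, and is the Beta-Binomial probability with parameters $(c_j,1,\theta/J)$: $$\pi_j(r)=\mathbb E\left[\binom{c_j}{r}V_j^r(1-V_j)^{c_j-r}\right]=\binom{c_j}{r}\frac{\theta}{J}\,\frac{\Gamma(r+1)\,\Gamma(\theta/J+c_j-r)}{\Gamma(\theta/J+c_j+1)}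 .$$ 3. For all such $n$ and $\mathbf c$, the smoothed frequency estimator is $$\mathbb E_{P\sim\mathrm{DP}(\theta,G_0)}[\varepsilon_f(P)]=c_j\,\frac{J}{\theta+J}.$$ -/

import Mathlib

open MeasureTheory ProbabilityTheory
open scoped ENNReal

namespace SmoothedSketch

/-! ### Hash functions -/

/-- The set of symbols that the hash function `g` sends to bucket `j`. -/
def bucket {S : Type*} {J : ℕ} (g : S → Fin J) (j : Fin J) : Set S := g ⁻¹' {j}

/-- Strong universality (pairwise independence) of the random hash function `h u`, `u ∼ Q`:
two distinct symbols are hashed to any two buckets with probability `J⁻²`. -/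
structure IsStronglyUniversal {U S : Type*} [MeasurableSpace U] {J : ℕ}
    (Q : Measure U) (h : U → S → Fin J) : Prop where
  measurable_eval : ∀ x, Measurable fun u => h u x
  pairwise : ∀ x y, x ≠ y → ∀ i j,
    Q {u | h u x = i ∧ h u y = j} = ((J : ℝ≥0∞) ^ 2)⁻¹

/-- The random hash function `h u`, `u ∼ Q`, is drawn independently of symbols drawn from `G₀`:
the probability that two independent draws from `G₀` are both hashed to `j` is the same whether
one first averages over the draws or over the hash function.  (Joint measurability of
`(u, x) ↦ h u x` would give this by Fubini, but a strongly universal family with `J ≥ 2` cannot be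
jointly measurable when `G₀` has no atoms, so the exchange of the two averages is all that can be
asked for.) -/
def IsIndepOfDraws {U S : Type*} [MeasurableSpace U] [MeasurableSpace S] {J : ℕ}
    (Q : Measure U) (h : U → S → Fin J) (G₀ : Measure S) : Prop :=
  ∀ j, AEMeasurable (fun u => (G₀.prod G₀) {p | h u p.1 = j ∧ h u p.2 = j}) Q ∧
    ∫⁻ u, (G₀.prod G₀) {p | h u p.1 = j ∧ h u p.2 = j} ∂Q
      = ∫⁻ p, Q {u | h u p.1 = j ∧ h u p.2 = j} ∂(G₀.prod G₀)

/-! ### The Dirichlet process -/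

/-- The Gamma distribution with shape `a ≥ 0` and rate `1`; it is the unit mass at `0` for
`a = 0`. -/
noncomputable def gammaLaw (a : ℝ) : Measure ℝ :=
  if a = 0 then Measure.dirac 0 else gammaMeasure a 1

/-- The Dirichlet distribution with parameters `α i ≥ 0`, not all zero: the law of independent
Gamma variables with shapes `α i`, divided by their sum. -/
noncomputable def dirichletLaw {k : ℕ} (α : Fin k → ℝ) : Measure (Fin k → ℝ) :=
  (Measure.pi fun i => gammaLaw (α i)).map fun y i => y i / ∑ l, y l

/-- `P ∼ DP(θ, G₀)`: `P` is a random probability measure whose values on every finite measurable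
partition `A` have the Dirichlet distribution with parameters `θ G₀(A i)`. -/
structure IsDirichletProcess {Ω S : Type*} [MeasurableSpace Ω] [MeasurableSpace S]
    (μ : Measure Ω) (P : Ω → Measure S) (θ : ℝ) (G₀ : Measure S) : Prop where
  measurable : Measurable P
  isProbabilityMeasure : ∀ ω, IsProbabilityMeasure (P ω)
  map_partition : ∀ (k : ℕ) (A : Fin k → Set S), (∀ i, MeasurableSet (A i)) →
    Pairwise (fun i i' => Disjoint (A i) (A i')) → (⋃ i, A i) = Set.univ →
    μ.map (fun ω i => (P ω).real (A i)) = dirichletLaw fun i => θ * G₀.real (A i)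

/-! ### The sampling model for a given hash function -/

/-- The sketch of the sample `x`: the number of sample points in each bucket. -/
def sketch {S : Type*} {J n : ℕ} (g : S → Fin J) (x : Fin n → S) (j : Fin J) : ℕ :=
  (Finset.univ.filter fun i => g (x i) = j).card

open Classical in
/-- The empirical frequency of the symbol `s` in the sample `x`. -/
noncomputable def freq {S : Type*} {n : ℕ} (x : Fin n → S) (s : S) : ℕ :=
  (Finset.univ.filter fun i => x i = s).card

/-- The conditional law of `(X₁, …, Xₙ, Xₙ₊₁)`, i.i.d. from `p`, given that `(X₁, …, Xₙ)` has
sketch `c` and that `Xₙ₊₁` is hashed to bucket `j`. -/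
noncomputable def condSample {S : Type*} [MeasurableSpace S] {J : ℕ} (g : S → Fin J) (n : ℕ)
    (c : Fin J → ℕ) (j : Fin J) (p : Measure S) : Measure (Fin (n + 1) → S) :=
  ProbabilityTheory.cond (Measure.pi fun _ : Fin (n + 1) => p)
    {x | sketch g (Fin.init x) = c ∧ g (x (Fin.last n)) = j}

/-- `π_j(r; p)`: the conditional probability that `Xₙ₊₁` has frequency `r` in the sample. -/
noncomputable def freqProb {S : Type*} [MeasurableSpace S] {J : ℕ} (g : S → Fin J) (n : ℕ)
    (c : Fin J → ℕ) (j : Fin J) (r : ℕ) (p : Measure S) : ℝ :=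
  (condSample g n c j p).real {x | freq (Fin.init x) (x (Fin.last n)) = r}

/-- `ε_f(p)`: the conditional expectation of the frequency of `Xₙ₊₁` in the sample. -/
noncomputable def freqMean {S : Type*} [MeasurableSpace S] {J : ℕ} (g : S → Fin J) (n : ℕ)
    (c : Fin J → ℕ) (j : Fin J) (p : Measure S) : ℝ :=
  ∫ x, (freq (Fin.init x) (x (Fin.last n)) : ℝ) ∂(condSample g n c j p)

/-- `p_j`: the law `p`, restricted to bucket `j` and renormalized. -/
noncomputable def bucketLaw {S : Type*} [MeasurableSpace S] {J : ℕ} (g : S → Fin J) (j : Fin J)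
    (p : Measure S) : Measure S :=
  ProbabilityTheory.cond p (bucket g j)

/-- The law of the mixing variable `V_j`, the mass `P_j {X}` that the random measure `P_j` gives
to a symbol `X` drawn from `P_j`. -/
noncomputable def mixingLaw {Ω S : Type*} [MeasurableSpace Ω] [MeasurableSpace S] {J : ℕ}
    (μ : Measure Ω) (P : Ω → Measure S) (g : S → Fin J) (j : Fin J) : Measure ℝ :=
  μ.bind fun ω => (bucketLaw g j (P ω)).map fun s => (bucketLaw g j (P ω)).real {s}

/-- The probability mass function of the Beta-Binomial distribution with parameters
`(m, a, b)`, at `r ≤ m`. -/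
noncomputable def betaBinomial (m : ℕ) (a b : ℝ) (r : ℕ) : ℝ :=
  (m.choose r : ℝ) * beta (a + r) (b + m - r) / beta a b

end SmoothedSketch

namespace SmoothedSketch

/-! ### Gamma variables and the moments of their ratios -/

/-! The theorem reduces to the law of `V_j`. Once the hash values of the sample are fixed, the
points in bucket `j` are i.i.d. from `p_j`, so given the sketch the frequency of a symbol `s` of
that bucket is Binomial with parameters `c j` and `p_j {s}`. The probability of the sketch cancels
in the conditioning (`pi_real_sketch_freq`, `freqProb_eq_integral`). Averaging over `s ∼ p_j` and
over `P` gives a Binomial mixture over `V_j`.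

Since `V_j` lies in `[0, 1]`, its law is determined by its moments (`ext_of_moments`). The `k`-th
moment is the mean of `∫ P_j {s} ^ k dP_j(s)`, which is the limit, along finite partitions that
separate points, of the mean of `∑ P_j(C) ^ (k + 1)` over the cells `C`. Each term is a
finite-dimensional Dirichlet moment: for `A ⊆ B`, the mean of `(P(A) / P(B)) ^ m` is `∏ i < m, (θ
G₀(A) + i) / (θ G₀(B) + i)`, computed from independent Gamma variables
(`lintegral_dirichletLaw_ratio_pow`). As the cells shrink, non-atomicity of `G₀` makes every factor
with `i ≥ 1` constant in the limit, while the factors with `i = 0` sum to `1` over the cells. What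
is left are the moments of `Beta(1, θ G₀(B))` (`tendsto_sum_rising`,
`IsDirichletProcess.lintegral_atom_pow`).

The even split of `G₀` is a second-moment argument: the bucket masses sum to `1` and each has mean
square `J⁻²`, so their total squared deviation from `1/J` has mean zero (`ae_bucket_eq_inv`). -/

theorem lintegral_rpow_mul_exp_neg_mul_Ioi {s r : ℝ} (hs : 0 < s) (hr : 0 < r) :
    ∫⁻ x in Set.Ioi (0 : ℝ), ENNReal.ofReal (x ^ (s - 1) * Real.exp (-(r * x)))
      = ENNReal.ofReal ((1 / r) ^ s * Real.Gamma s) := by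
  rw [← Real.integral_rpow_mul_exp_neg_mul_Ioi hs hr, ofReal_integral_eq_lintegral_ofReal]
  -- Integrability is read off from the known value: a non-integrable function would have integral
  -- `0`, but the value is positive.
  · by_contra hint
    have h0 := Real.integral_rpow_mul_exp_neg_mul_Ioi hs hr
    rw [integral_undef hint] at h0
    have : 0 < (1 / r) ^ s * Real.Gamma s := by positivity
    exact this.ne h0
  · refine (ae_restrict_iff' measurableSet_Ioi).mpr (ae_of_all _ fun x (hx : 0 < x) => ?_)
    positivity

theorem isProbabilityMeasure_gammaLaw {a : ℝ} (ha : 0 ≤ a) :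
    IsProbabilityMeasure (gammaLaw a) := by
  unfold gammaLaw
  split_ifs with h
  · infer_instance
  · exact isProbabilityMeasure_gammaMeasure (lt_of_le_of_ne ha (Ne.symm h)) one_pos

theorem lintegral_gammaLaw {a : ℝ} (ha : 0 < a) {f : ℝ → ℝ≥0∞} (hf : Measurable f) :
    ∫⁻ x, f x ∂gammaLaw a
      = ∫⁻ x in Set.Ioi (0 : ℝ),
          ENNReal.ofReal (x ^ (a - 1) * Real.exp (-x) / Real.Gamma a) * f x := by
  have hm : Measurable (gammaPDF a 1) := (measurable_gammaPDFReal a 1).ennreal_ofReal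
  rw [gammaLaw, if_neg ha.ne', gammaMeasure, lintegral_withDensity_eq_lintegral_mul _ hm hf]
  simp only [Pi.mul_apply]
  rw [← lintegral_add_compl _ (measurableSet_Iio (a := (0 : ℝ))), Set.compl_Iio,
    setLIntegral_congr_fun (g := fun _ => 0) measurableSet_Iio
      (fun x (hx : x < 0) => by simp [gammaPDF_of_neg hx]),
    lintegral_zero, zero_add, setLIntegral_congr Ioi_ae_eq_Ici.symm]
  refine setLIntegral_congr_fun measurableSet_Ioi fun x (hx : 0 < x) => ?_
  simp only [gammaPDF_of_nonneg hx.le, Real.one_rpow, one_mul]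
  congr 2
  ring

theorem gammaLaw_ae_nonneg {a : ℝ} (ha : 0 ≤ a) : ∀ᵐ x ∂gammaLaw a, 0 ≤ x := by
  rcases ha.eq_or_lt with rfl | ha
  · rw [gammaLaw, if_pos rfl, ae_dirac_iff measurableSet_Ici]
  · have hm : MeasurableSet {x : ℝ | ¬ 0 ≤ x} := (measurableSet_Ici (a := (0:ℝ))).compl
    rw [ae_iff, ← lintegral_indicator_one hm, lintegral_gammaLaw ha (measurable_one.indicator hm)]
    refine setLIntegral_eq_zero measurableSet_Ioi fun x (hx : 0 < x) => ?_
    simp [Set.indicator, hx.le]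

theorem gammaLaw_ae_pos {a : ℝ} (ha : 0 < a) : ∀ᵐ x ∂gammaLaw a, 0 < x := by
  have hm : MeasurableSet {x : ℝ | ¬ 0 < x} := (measurableSet_Ioi (a := (0:ℝ))).compl
  rw [ae_iff, ← lintegral_indicator_one hm, lintegral_gammaLaw ha (measurable_one.indicator hm)]
  refine setLIntegral_eq_zero measurableSet_Ioi fun x (hx : 0 < x) => ?_
  have : ¬ x ≤ 0 := not_le.2 hx
  simp [Set.indicator, this]

theorem Gamma_add_nat {a : ℝ} (ha : 0 < a) (k : ℕ) :
    Real.Gamma (a + k) = (∏ i ∈ Finset.range k, (a + i)) * Real.Gamma a := by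
  induction k with
  | zero => simp
  | succ k ih =>
    have : a + k ≠ 0 := by positivity
    rw [Finset.prod_range_succ, Nat.cast_succ, ← add_assoc, Real.Gamma_add_one this, ih]
    ring

/-- The moments of an exponentially tilted Gamma law. -/
theorem lintegral_pow_mul_exp_gammaLaw {a t : ℝ} (ha : 0 ≤ a) (ht : 0 ≤ t) (k : ℕ) :
    ∫⁻ x, ENNReal.ofReal (x ^ k * Real.exp (-(t * x))) ∂gammaLaw a
      = ENNReal.ofReal ((∏ i ∈ Finset.range k, (a + i)) * (1 / (1 + t)) ^ (a + k)) := by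
  have hmeas : Measurable fun x : ℝ => ENNReal.ofReal (x ^ k * Real.exp (-(t * x))) := by
    fun_prop
  rcases ha.eq_or_lt with rfl | ha
  · rw [gammaLaw, if_pos rfl, lintegral_dirac' _ hmeas]
    rcases k with _ | k
    · simp
    · simp [Finset.prod_range_succ']
  · rw [lintegral_gammaLaw ha hmeas]
    have hk : 0 < a + k := by positivity
    have ht1 : 0 < 1 + t := by positivity
    calc _ = ∫⁻ x in Set.Ioi (0 : ℝ), ENNReal.ofReal (1 / Real.Gamma a)
            * ENNReal.ofReal (x ^ (a + k - 1) * Real.exp (-((1 + t) * x))) := by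
          refine setLIntegral_congr_fun measurableSet_Ioi fun x (hx : 0 < x) => ?_
          rw [← ENNReal.ofReal_mul (by positivity), ← ENNReal.ofReal_mul (by positivity)]
          have h1 : x ^ (a + k - 1) = x ^ (a - 1) * x ^ k := by
            rw [← Real.rpow_natCast, ← Real.rpow_add hx]; ring_nf
          have h2 : Real.exp (-((1 + t) * x)) = Real.exp (-x) * Real.exp (-(t * x)) := by
            rw [← Real.exp_add]; ring_nf
          rw [h1, h2]
          congr 1
          ring
      _ = _ := by
          rw [lintegral_const_mul' _ _ ENNReal.ofReal_ne_top,
            lintegral_rpow_mul_exp_neg_mul_Ioi hk ht1, Gamma_add_nat ha,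
            ← ENNReal.ofReal_mul (by positivity)]
          congr 1
          have := (Real.Gamma_pos_of_pos ha).ne'
          field_simp

/-- The Laplace representation of the ratio moment. -/
theorem ofReal_div_add_pow {x y : ℝ} (hx : 0 ≤ x) (hy : 0 ≤ y) {k : ℕ} (hk : 0 < k) :
    ENNReal.ofReal ((x / (x + y)) ^ k)
      = ∫⁻ t in Set.Ioi (0 : ℝ), ENNReal.ofReal (t ^ ((k : ℝ) - 1) / Real.Gamma k)
          * (ENNReal.ofReal (x ^ k * Real.exp (-(t * x)))
            * ENNReal.ofReal (y ^ 0 * Real.exp (-(t * y)))) := by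
  have hk' : (0 : ℝ) < k := by exact_mod_cast hk
  rcases hx.eq_or_lt with rfl | hx
  · simp [hk.ne']
  · have hxy : 0 < x + y := by positivity
    calc _ = ENNReal.ofReal (x ^ k / Real.Gamma k) *
          ∫⁻ t in Set.Ioi (0 : ℝ),
            ENNReal.ofReal (t ^ ((k : ℝ) - 1) * Real.exp (-((x + y) * t))) := by
          rw [lintegral_rpow_mul_exp_neg_mul_Ioi hk' hxy, ← ENNReal.ofReal_mul (by positivity)]
          congr 1
          have := (Real.Gamma_pos_of_pos hk').ne'
          rw [Real.rpow_natCast, div_pow, div_pow, one_pow]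
          field_simp
      _ = _ := by
          rw [← lintegral_const_mul' _ _ ENNReal.ofReal_ne_top]
          refine setLIntegral_congr_fun measurableSet_Ioi fun t (ht : 0 < t) => ?_
          rw [← ENNReal.ofReal_mul (by positivity), ← ENNReal.ofReal_mul (by positivity),
            ← ENNReal.ofReal_mul (by positivity)]
          have h2 : Real.exp (-((x + y) * t)) = Real.exp (-(t * x)) * Real.exp (-(t * y)) := by
            rw [← Real.exp_add]; ring_nf
          rw [h2]
          congr 1
          ring

/-- Writing the ratio as a Laplace integral decouples the two variables, and Tonelli applies. The
remaining `t`-integral depends on `a` and `c` only through `a + c`, so it can stay unevaluated. -/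
theorem lintegral_gammaLaw_ratio_pow_eq {a c : ℝ} (ha : 0 ≤ a) (hc : 0 ≤ c) {k : ℕ}
    (hk : 0 < k) :
    ∫⁻ x, ∫⁻ y, ENNReal.ofReal ((x / (x + y)) ^ k) ∂gammaLaw c ∂gammaLaw a
      = ENNReal.ofReal (∏ i ∈ Finset.range k, (a + i)) *
        ∫⁻ t in Set.Ioi (0 : ℝ), ENNReal.ofReal (t ^ ((k : ℝ) - 1) / Real.Gamma k)
          * ENNReal.ofReal ((1 / (1 + t)) ^ (a + c + k)) := by
  have := isProbabilityMeasure_gammaLaw ha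
  have := isProbabilityMeasure_gammaLaw hc
  have hprod : 0 ≤ ∏ i ∈ Finset.range k, (a + (i : ℝ)) :=
    Finset.prod_nonneg fun i _ => by positivity
  calc _ = ∫⁻ x, ∫⁻ y, (∫⁻ t in Set.Ioi (0 : ℝ),
          ENNReal.ofReal (t ^ ((k : ℝ) - 1) / Real.Gamma k)
          * (ENNReal.ofReal (x ^ k * Real.exp (-(t * x)))
            * ENNReal.ofReal (y ^ 0 * Real.exp (-(t * y))))) ∂gammaLaw c ∂gammaLaw a := by
        refine lintegral_congr_ae ?_
        filter_upwards [gammaLaw_ae_nonneg ha] with x hx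
        refine lintegral_congr_ae ?_
        filter_upwards [gammaLaw_ae_nonneg hc] with y hy
        exact ofReal_div_add_pow hx hy hk
    _ = ∫⁻ x, (∫⁻ t in Set.Ioi (0 : ℝ), ∫⁻ y,
          ENNReal.ofReal (t ^ ((k : ℝ) - 1) / Real.Gamma k)
          * (ENNReal.ofReal (x ^ k * Real.exp (-(t * x)))
            * ENNReal.ofReal (y ^ 0 * Real.exp (-(t * y)))) ∂gammaLaw c) ∂gammaLaw a := by
        refine lintegral_congr fun x => ?_
        rw [lintegral_lintegral_swap]
        exact Measurable.aemeasurable (by fun_prop)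
    _ = ∫⁻ t in Set.Ioi (0 : ℝ), ∫⁻ x, ∫⁻ y,
          ENNReal.ofReal (t ^ ((k : ℝ) - 1) / Real.Gamma k)
          * (ENNReal.ofReal (x ^ k * Real.exp (-(t * x)))
            * ENNReal.ofReal (y ^ 0 * Real.exp (-(t * y)))) ∂gammaLaw c ∂gammaLaw a := by
        rw [lintegral_lintegral_swap]
        refine Measurable.aemeasurable ?_
        exact Measurable.lintegral_prod_right' (f := fun p : (ℝ × ℝ) × ℝ =>
          ENNReal.ofReal (p.1.2 ^ ((k : ℝ) - 1) / Real.Gamma k)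
          * (ENNReal.ofReal (p.1.1 ^ k * Real.exp (-(p.1.2 * p.1.1)))
            * ENNReal.ofReal (p.2 ^ 0 * Real.exp (-(p.1.2 * p.2))))) (by fun_prop)
    _ = ∫⁻ t in Set.Ioi (0 : ℝ), ENNReal.ofReal (∏ i ∈ Finset.range k, (a + (i : ℝ))) *
          (ENNReal.ofReal (t ^ ((k : ℝ) - 1) / Real.Gamma k)
          * ENNReal.ofReal ((1 / (1 + t)) ^ (a + c + k))) := by
        refine setLIntegral_congr_fun measurableSet_Ioi fun t (ht : 0 < t) => ?_
        have hmx : Measurable fun x : ℝ => ENNReal.ofReal (x ^ k * Real.exp (-(t * x))) := by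
          fun_prop
        simp_rw [lintegral_const_mul' _ _ ENNReal.ofReal_ne_top,
          lintegral_pow_mul_exp_gammaLaw hc ht.le]
        rw [lintegral_mul_const _ hmx, lintegral_pow_mul_exp_gammaLaw ha ht.le]
        have h1 : (1 / (1 + t)) ^ (a + c + k)
            = (1 / (1 + t)) ^ (a + k) * (1 / (1 + t)) ^ (c + (0 : ℕ)) := by
          rw [← Real.rpow_add (by positivity)]
          congr 1
          push_cast
          ring
        rw [h1, ENNReal.ofReal_mul hprod,
          ENNReal.ofReal_mul (p := (1 / (1 + t)) ^ (a + k)) (by positivity)]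
        simp only [Finset.range_zero, Finset.prod_empty, one_mul]
        ring
    _ = _ := by rw [lintegral_const_mul' _ _ ENNReal.ofReal_ne_top]

/-- The moments of `X / (X + Y)` for independent Gamma variables `X` and `Y`, one of which may
vanish. -/
theorem lintegral_gammaLaw_ratio_pow {a c : ℝ} (ha : 0 ≤ a) (hc : 0 ≤ c) (hac : 0 < a + c)
    {k : ℕ} (hk : 0 < k) :
    ∫⁻ x, ∫⁻ y, ENNReal.ofReal ((x / (x + y)) ^ k) ∂gammaLaw c ∂gammaLaw a
      = ENNReal.ofReal (∏ i ∈ Finset.range k, (a + i) / (a + c + i)) := by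
  -- Replacing `(a, c)` by `(a + c, 0)` leaves the `t`-integral unchanged and makes the ratio almost
  -- surely `1`. This determines the integral without computing it.
  have h1 : ∫⁻ x, ∫⁻ y, ENNReal.ofReal ((x / (x + y)) ^ k) ∂gammaLaw 0 ∂gammaLaw (a + c) = 1 := by
    have := isProbabilityMeasure_gammaLaw hac.le
    calc _ = ∫⁻ x, 1 ∂gammaLaw (a + c) := by
          refine lintegral_congr_ae ?_
          filter_upwards [gammaLaw_ae_pos hac] with x hx
          rw [gammaLaw, if_pos rfl, lintegral_dirac]
          simp [div_self hx.ne']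
      _ = 1 := by simp
  rw [lintegral_gammaLaw_ratio_pow_eq hac.le le_rfl hk, add_zero] at h1
  have hpos : 0 < ∏ i ∈ Finset.range k, (a + c + (i : ℝ)) :=
    Finset.prod_pos fun i _ => by positivity
  rw [lintegral_gammaLaw_ratio_pow_eq ha hc hk, ENNReal.eq_inv_of_mul_eq_one_left
    ((mul_comm _ _).trans h1), Finset.prod_div_distrib, ENNReal.ofReal_div_of_pos hpos,
    div_eq_mul_inv]

/-! ### From Gamma ratios to Dirichlet ratios -/

theorem measurePreserving_pi_fin_three (ν : Fin 3 → Measure ℝ) [∀ i, IsProbabilityMeasure (ν i)] :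
    MeasurePreserving (fun y : Fin 3 → ℝ => (y 0, y 1)) (Measure.pi ν) ((ν 0).prod (ν 1)) := by
  have hm : Measurable fun y : Fin 3 → ℝ => (y 0, y 1) := by fun_prop
  refine ⟨hm, (Measure.prod_eq fun s t hs ht => ?_).symm⟩
  rw [Measure.map_apply hm (hs.prod ht)]
  have : (fun y : Fin 3 → ℝ => (y 0, y 1)) ⁻¹' s ×ˢ t = Set.univ.pi ![s, t, Set.univ] := by
    ext y
    simp [Set.mem_pi, Fin.forall_fin_succ]
  rw [this, Measure.pi_pi, Fin.prod_univ_three]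
  simp

/-- The normalizing sum cancels in the ratio, so only the first two Gamma variables matter. -/
theorem lintegral_dirichletLaw_ratio_pow {α : Fin 3 → ℝ} (hα : ∀ i, 0 ≤ α i)
    (h01 : 0 < α 0 + α 1) {k : ℕ} (hk : 0 < k) :
    ∫⁻ y, ENNReal.ofReal ((y 0 / (y 0 + y 1)) ^ k) ∂dirichletLaw α
      = ENNReal.ofReal (∏ i ∈ Finset.range k, (α 0 + i) / (α 0 + α 1 + i)) := by
  have := fun i => isProbabilityMeasure_gammaLaw (hα i)
  have hm : Measurable fun p : ℝ × ℝ => ENNReal.ofReal ((p.1 / (p.1 + p.2)) ^ k) := by fun_prop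
  rw [dirichletLaw, lintegral_map (by fun_prop) (by fun_prop),
    ← lintegral_gammaLaw_ratio_pow (hα 0) (hα 1) h01 hk, ← lintegral_prod _ hm.aemeasurable,
    ← (measurePreserving_pi_fin_three fun i => gammaLaw (α i)).lintegral_comp hm]
  refine lintegral_congr_ae ?_
  have hnn : ∀ᵐ y ∂Measure.pi fun i => gammaLaw (α i), ∀ i, 0 ≤ y i :=
    ae_all_iff.2 fun i =>
      (measurePreserving_eval (fun i => gammaLaw (α i)) i).quasiMeasurePreserving.ae
        (gammaLaw_ae_nonneg (hα i))
  filter_upwards [hnn] with y hy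
  rcases (Finset.sum_nonneg fun i (_ : i ∈ Finset.univ) => hy i).eq_or_lt with h0 | h0
  -- If the sum vanishes, so does every coordinate, and both sides agree by the convention `0 / 0 =
  -- 0`.
  · have := (Finset.sum_eq_zero_iff_of_nonneg fun i (_ : i ∈ Finset.univ) => hy i).1 h0.symm
    simp [this]
  · rw [← add_div, div_div_div_cancel_right₀ h0.ne']

/-! ### Relative masses under a Dirichlet process -/

section DirichletProcess

variable {Ω S : Type*} [MeasurableSpace Ω] [MeasurableSpace S] {μ : Measure Ω}
  {P : Ω → Measure S} {θ : ℝ} {G₀ : Measure S}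

theorem IsDirichletProcess.lintegral_ratio_pow [IsProbabilityMeasure G₀]
    (hP : IsDirichletProcess μ P θ G₀) (hθ : 0 < θ)
    {A B : Set S} (hA : MeasurableSet A) (hB : MeasurableSet B) (hAB : A ⊆ B)
    (hB0 : 0 < G₀.real B) {k : ℕ} (hk : 0 < k) :
    ∫⁻ ω, ENNReal.ofReal (((P ω).real A / (P ω).real B) ^ k) ∂μ
      = ENNReal.ofReal (∏ i ∈ Finset.range k, (θ * G₀.real A + i) / (θ * G₀.real B + i)) := by
  have := hP.isProbabilityMeasure
  -- The first two cells make up `B`, so the mass of `B` is the sum of the first two Dirichlet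
  -- coordinates.
  let E : Fin 3 → Set S := ![A, B \ A, Bᶜ]
  have hE : ∀ i, MeasurableSet (E i) := by
    simp [Fin.forall_fin_succ, E, hA, hB, hB.diff hA]
  have hd : Pairwise fun i i' => Disjoint (E i) (E i') := by
    have h1 : Disjoint A (B \ A) := Set.disjoint_sdiff_right
    have h2 : Disjoint A Bᶜ := Set.disjoint_compl_right_iff_subset.2 hAB
    have h3 : Disjoint (B \ A) Bᶜ := Set.disjoint_compl_right_iff_subset.2 Set.sdiff_subset
    intro i i' hii
    fin_cases i <;> fin_cases i' <;> simp_all [E, disjoint_comm]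
  have hU : (⋃ i, E i) = Set.univ := by
    refine Set.eq_univ_of_forall fun s => ?_
    by_cases hs : s ∈ A
    · exact Set.mem_iUnion.2 ⟨0, hs⟩
    by_cases hs' : s ∈ B
    · exact Set.mem_iUnion.2 ⟨1, hs', hs⟩
    · exact Set.mem_iUnion.2 ⟨2, hs'⟩
  have hsum : ∀ (p : Measure S) [IsProbabilityMeasure p], p.real A + p.real (B \ A) = p.real B :=
    fun p _ => by rw [measureReal_sdiff hAB hA]; ring
  have hlaw := hP.map_partition 3 E hE hd hU
  have hmP : Measurable fun ω i => (P ω).real (E i) :=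
    measurable_pi_lambda _ fun i =>
      ((Measure.measurable_coe (hE i)).comp hP.measurable).ennreal_toReal
  have key := lintegral_dirichletLaw_ratio_pow (α := fun i => θ * G₀.real (E i))
    (fun i => by positivity) (by
      simp only [E, Matrix.cons_val_zero, Matrix.cons_val_one]
      rw [← mul_add, hsum]; positivity) hk
  rw [← hlaw, lintegral_map (by fun_prop) hmP] at key
  simpa only [E, Matrix.cons_val_zero, Matrix.cons_val_one, ← mul_add, hsum] using key

/-- With `0 / 0 = 0`, the ratio `P(B) / P(B)` is the indicator of `P(B) ≠ 0`. Its mean is the ratio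
moment with `A = B` and `k = 1`, which equals `1`. -/
theorem IsDirichletProcess.ae_pos [IsProbabilityMeasure G₀] [IsProbabilityMeasure μ]
    (hP : IsDirichletProcess μ P θ G₀) (hθ : 0 < θ) {B : Set S} (hB : MeasurableSet B)
    (hB0 : 0 < G₀.real B) : ∀ᵐ ω ∂μ, P ω B ≠ 0 := by
  have := hP.isProbabilityMeasure
  have h1 := hP.lintegral_ratio_pow hθ hB hB subset_rfl hB0 one_pos
  have hmB : Measurable fun ω => P ω B := (Measure.measurable_coe hB).comp hP.measurable
  have hms : MeasurableSet {ω | P ω B ≠ 0} := (hmB (measurableSet_singleton 0)).compl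
  have h2 : ∫⁻ ω, ENNReal.ofReal (((P ω).real B / (P ω).real B) ^ 1) ∂μ
      = μ {ω | P ω B ≠ 0} := by
    rw [← lintegral_indicator_one hms]
    refine lintegral_congr fun ω => ?_
    by_cases h : P ω B = 0
    · simp [measureReal_def, h]
    · have : (P ω).real B ≠ 0 := (measureReal_ne_zero_iff).2 h
      simp [h, div_self this]
  have h3 : θ * G₀.real B ≠ 0 := (mul_pos hθ hB0).ne'
  rw [h2] at h1
  simp only [Finset.range_one, Finset.prod_singleton, Nat.cast_zero, add_zero, div_self h3,
    ENNReal.ofReal_one] at h1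
  exact (prob_compl_eq_zero_iff hms).2 h1

end DirichletProcess

open Filter Topology

/-! ### Laws on the unit interval -/

theorem integrable_of_continuous_of_ae_mem_Icc {μ : Measure ℝ} [IsFiniteMeasure μ]
    (hμ : ∀ᵐ x ∂μ, x ∈ Set.Icc (0 : ℝ) 1) {f : ℝ → ℝ} (hf : Continuous f) : Integrable f μ := by
  obtain ⟨C, hC⟩ := isCompact_Icc.exists_bound_of_continuousOn (hf.continuousOn (s := Set.Icc 0 1))
  exact Integrable.of_bound hf.aestronglyMeasurable C (hμ.mono hC)

/-- Probability laws on the unit interval are determined by their moments. -/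
theorem ext_of_moments {μ ν : Measure ℝ} [IsProbabilityMeasure μ] [IsProbabilityMeasure ν]
    (hμ : ∀ᵐ x ∂μ, x ∈ Set.Icc (0 : ℝ) 1) (hν : ∀ᵐ x ∂ν, x ∈ Set.Icc (0 : ℝ) 1)
    (h : ∀ k : ℕ, ∫ x, x ^ k ∂μ = ∫ x, x ^ k ∂ν) : μ = ν := by
  have hpoly : ∀ p : Polynomial ℝ, ∫ x, p.eval x ∂μ = ∫ x, p.eval x ∂ν := by
    intro p
    have hint : ∀ ρ : Measure ℝ, [IsProbabilityMeasure ρ] →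
        (∀ᵐ x ∂ρ, x ∈ Set.Icc (0 : ℝ) 1) → ∫ x, p.eval x ∂ρ
          = ∑ i ∈ Finset.range (p.natDegree + 1), p.coeff i * ∫ x, x ^ i ∂ρ := by
      intro ρ _ hρ
      simp_rw [Polynomial.eval_eq_sum_range]
      rw [integral_finsetSum _ fun i _ =>
        integrable_of_continuous_of_ae_mem_Icc hρ (by fun_prop)]
      simp_rw [integral_const_mul]
    rw [hint μ hμ, hint ν hν]
    simp_rw [h]
  refine ext_of_forall_integral_eq_of_IsFiniteMeasure fun f => ?_
  refine eq_of_forall_dist_le fun ε hε => ?_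
  -- Weierstrass on `[0, 1]` suffices, because both laws are carried by this interval.
  obtain ⟨p, hp⟩ := exists_polynomial_near_of_continuousOn 0 1 f f.continuous.continuousOn
    (ε / 2) (half_pos hε)
  have hnear : ∀ ρ : Measure ℝ, [IsProbabilityMeasure ρ] →
      (∀ᵐ x ∂ρ, x ∈ Set.Icc (0 : ℝ) 1) → dist (∫ x, p.eval x ∂ρ) (∫ x, f x ∂ρ) ≤ ε / 2 := by
    intro ρ _ hρ
    rw [dist_eq_norm, ← integral_sub (integrable_of_continuous_of_ae_mem_Icc hρ p.continuous)
      (integrable_of_continuous_of_ae_mem_Icc hρ f.continuous)]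
    simpa using norm_integral_le_of_norm_le_const (μ := ρ) (C := ε / 2)
      (f := fun x => p.eval x - f x) (hρ.mono fun x hx => (hp x hx).le)
  calc _ ≤ dist (∫ x, f x ∂μ) (∫ x, p.eval x ∂μ) + dist (∫ x, p.eval x ∂μ) (∫ x, f x ∂ν) :=
        dist_triangle _ _ _
    _ ≤ ε / 2 + ε / 2 := by
        refine add_le_add ?_ ?_
        · rw [dist_comm]; exact hnear μ hμ
        · rw [hpoly]; exact hnear ν hν
    _ = ε := add_halves ε

/-! ### Moments of the Beta law -/

theorem betaMeasure_ae_mem_Icc (a b : ℝ) : ∀ᵐ x ∂betaMeasure a b, x ∈ Set.Icc (0 : ℝ) 1 := by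
  have hm : Measurable (betaPDF a b) := (measurable_betaPDFReal a b).ennreal_ofReal
  rw [betaMeasure, ae_withDensity_iff hm]
  refine ae_of_all _ fun x hx => ⟨?_, ?_⟩ <;> by_contra! hlt
  · exact hx (betaPDF_eq_zero_of_nonpos hlt.le)
  · exact hx (betaPDF_eq_zero_of_one_le hlt.le)

/-- Multiplying the density by `x ^ r * (1 - x) ^ q` gives the Beta density with shifted parameters,
up to the ratio of normalizing constants; that density has total mass `1`. -/
theorem integral_pow_mul_pow_betaMeasure {a b : ℝ} (ha : 0 < a) (hb : 0 < b) (r q : ℕ) :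
    ∫ x, x ^ r * (1 - x) ^ q ∂betaMeasure a b = beta (a + r) (b + q) / beta a b := by
  have hm : Measurable (betaPDF a b) := (measurable_betaPDFReal a b).ennreal_ofReal
  have har : 0 < a + r := by positivity
  have hbq : 0 < b + q := by positivity
  have hb0 := beta_pos ha hb
  have hb1 := beta_pos har hbq
  rw [integral_eq_lintegral_of_nonneg_ae
    ((betaMeasure_ae_mem_Icc a b).mono fun x hx =>
      mul_nonneg (pow_nonneg hx.1 _) (pow_nonneg (sub_nonneg.2 hx.2) _))
    (by fun_prop), betaMeasure, lintegral_withDensity_eq_lintegral_mul _ hm (by fun_prop)]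
  have : ∀ x, (betaPDF a b * fun x => ENNReal.ofReal (x ^ r * (1 - x) ^ q)) x
      = ENNReal.ofReal (beta (a + r) (b + q) / beta a b) * betaPDF (a + r) (b + q) x := by
    intro x
    simp only [Pi.mul_apply]
    by_cases hx : 0 < x ∧ x < 1
    · have hx1 : 0 < 1 - x := by linarith [hx.2]
      rw [betaPDF_of_pos_lt_one hx.1 hx.2, betaPDF_of_pos_lt_one hx.1 hx.2,
        ← ENNReal.ofReal_mul (by have := hx.1; positivity), ← ENNReal.ofReal_mul (by positivity)]
      have e1 : x ^ (a + r - 1) = x ^ (a - 1) * x ^ r := by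
        rw [← Real.rpow_natCast, ← Real.rpow_add hx.1]; ring_nf
      have e2 : (1 - x) ^ (b + q - 1) = (1 - x) ^ (b - 1) * (1 - x) ^ q := by
        rw [← Real.rpow_natCast, ← Real.rpow_add hx1]; ring_nf
      rw [e1, e2]
      congr 1
      field_simp
    · simp [betaPDF_eq, hx]
  rw [lintegral_congr this, lintegral_const_mul' _ _ ENNReal.ofReal_ne_top,
    lintegral_betaPDF_eq_one har hbq, mul_one, ENNReal.toReal_ofReal (by positivity)]

theorem integral_pow_betaMeasure_one {b : ℝ} (hb : 0 < b) (k : ℕ) :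
    ∫ x, x ^ k ∂betaMeasure 1 b = ∏ i ∈ Finset.range k, ((1 + i) / (b + 1 + i) : ℝ) := by
  have h := integral_pow_mul_pow_betaMeasure one_pos hb k 0
  simp only [pow_zero, mul_one, Nat.cast_zero, add_zero] at h
  have h1 : (1 : ℝ) + k + b = (b + 1) + k := by ring
  have hb1 : 0 < b + 1 := by positivity
  rw [h, beta, beta, h1, add_comm 1 b, Gamma_add_nat one_pos, Gamma_add_nat hb1,
    Finset.prod_div_distrib]
  have := (Real.Gamma_pos_of_pos hb).ne'
  have := (Real.Gamma_pos_of_pos hb1).ne'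
  have : ∏ i ∈ Finset.range k, (b + 1 + (i : ℝ)) ≠ 0 :=
    (Finset.prod_pos fun i _ => by positivity).ne'
  rw [Real.Gamma_one]
  field_simp

/-! ### Partitions that separate points -/

section CountablySeparated

variable {S : Type*} [MeasurableSpace S]

/-- The diagonal is pulled back from that of `ℕ → Bool` along an injective measurable code. It makes
frequencies and point masses measurable. -/
theorem measurableEq_of_countablySeparated [MeasurableSpace.CountablySeparated S] :
    MeasurableEq S := by
  obtain ⟨f, hf, hinj⟩ := MeasurableSpace.measurable_injection_nat_bool_of_countablySeparated S
  refine ⟨?_⟩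
  have := measurableSet_eq_fun (hf.comp (measurable_fst (α := S) (β := S)))
    (hf.comp (measurable_snd (α := S) (β := S)))
  convert this using 1
  ext p
  simp [hinj.eq_iff]

/-- The first `m` coordinates of the code of a point. -/
def label (f : S → ℕ → Bool) (m : ℕ) (s : S) : Fin m → Bool := fun i => f s i

theorem measurable_label {f : S → ℕ → Bool} (hf : Measurable f) (m : ℕ) :
    Measurable (label f m) :=
  measurable_pi_lambda _ fun i => (measurable_pi_apply (i : ℕ)).comp hf

/-- The points that have the same first `m` coordinates as `s`. -/
def cell (f : S → ℕ → Bool) (m : ℕ) (s : S) : Set S := label f m ⁻¹' {label f m s}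

theorem measurableSet_cell {f : S → ℕ → Bool} (hf : Measurable f) (m : ℕ) (s : S) :
    MeasurableSet (cell f m s) :=
  measurable_label hf m (measurableSet_singleton _)

theorem tendsto_measure_cell {f : S → ℕ → Bool} (hf : Measurable f)
    (hinj : Function.Injective f) (ν : Measure S) [IsFiniteMeasure ν] (s : S) :
    Tendsto (fun m => ν (cell f m s)) atTop (𝓝 (ν {s})) := by
  have hs : ({s} : Set S) = ⋂ m, cell f m s := by
    ext t
    simp only [Set.mem_singleton_iff, Set.mem_iInter, cell, Set.mem_preimage]
    refine ⟨fun h m => by rw [h], fun h => hinj (funext fun i => ?_)⟩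
    -- Length `i + 1` is the first at which the label contains coordinate `i`.
    exact congrFun (h (i + 1)) ⟨i, i.lt_succ_self⟩
  rw [hs]
  refine tendsto_measure_iInter_atTop (fun m => (measurableSet_cell hf m s).nullMeasurableSet)
    (fun m m' hm t ht => ?_) ⟨0, measure_ne_top _ _⟩
  simp only [cell, Set.mem_preimage, Set.mem_singleton_iff] at ht ⊢
  funext i
  exact congrFun ht (Fin.castLE hm i)

theorem lintegral_label {f : S → ℕ → Bool} (hf : Measurable f) (m : ℕ) (ν : Measure S)
    (ψ : (Fin m → Bool) → ℝ≥0∞) :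
    ∫⁻ s, ψ (label f m s) ∂ν = ∑ w, ψ w * ν (label f m ⁻¹' {w}) := by
  rw [← lintegral_map (measurable_of_finite ψ) (measurable_label hf m), lintegral_fintype]
  refine Finset.sum_congr rfl fun w _ => ?_
  rw [Measure.map_apply (measurable_label hf m) (measurableSet_singleton w)]

end CountablySeparated

/-! ### The mass at a point drawn from a normalized restriction of a Dirichlet process -/

section Moments

variable {Ω S : Type*} [MeasurableSpace Ω] [MeasurableSpace S] {μ : Measure Ω}
  {P : Ω → Measure S} {θ : ℝ} {G₀ : Measure S}

theorem measurable_cond {B : Set S} (hP : Measurable P) (hB : MeasurableSet B) :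
    Measurable fun ω => ProbabilityTheory.cond (P ω) B := by
  refine Measure.measurable_of_measurable_coe _ fun A hA => ?_
  simp_rw [cond_apply hB]
  exact ((Measure.measurable_coe hB).comp hP).inv.mul
    ((Measure.measurable_coe (hB.inter hA)).comp hP)

theorem cond_real_eq_div {B : Set S} (hB : MeasurableSet B) (p : Measure S) (A : Set S) :
    (ProbabilityTheory.cond p B).real A = p.real (B ∩ A) / p.real B := by
  rw [measureReal_def, cond_apply hB, ENNReal.toReal_mul, ENNReal.toReal_inv, div_eq_inv_mul]
  rfl

/-- One factor of `q(C) ^ (k + 1)` acts as the weight of the cell, so the sum is the `q`-mean of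
`q(cell of s) ^ k`. The cells decrease to `{s}`, and `1` dominates. -/
theorem lintegral_atom_pow_eq_lim {f : S → ℕ → Bool} (hf : Measurable f)
    (hinj : Function.Injective f) (q : Measure S) [IsZeroOrProbabilityMeasure q] (k : ℕ) :
    Tendsto (fun m => ∑ w, q (label f m ⁻¹' {w}) ^ (k + 1)) atTop
      (𝓝 (∫⁻ s, q {s} ^ k ∂q)) := by
  have h : ∀ m, ∑ w, q (label f m ⁻¹' {w}) ^ (k + 1) = ∫⁻ s, q (cell f m s) ^ k ∂q := fun m => by
    simp_rw [pow_succ]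
    exact (lintegral_label hf m q fun w => q (label f m ⁻¹' {w}) ^ k).symm
  simp_rw [h]
  refine tendsto_lintegral_of_dominated_convergence (fun _ => 1) (fun m => ?_)
    (fun m => ae_of_all _ fun s => pow_le_one' prob_le_one k)
    (by simp [measure_ne_top]) (ae_of_all _ fun s => ?_)
  · exact (measurable_of_finite fun w => q (label f m ⁻¹' {w}) ^ k).comp (measurable_label hf m)
  · exact ENNReal.Tendsto.pow (tendsto_measure_cell hf hinj q s)

/-- The factor `i = 0` is proportional to the `G₀`-mass of the cell inside `B` and serves as its
weight. The sum becomes an integral of the other factors, in which the cell masses tend to `0`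
because `G₀` has no atoms. -/
theorem tendsto_sum_rising {f : S → ℕ → Bool} (hf : Measurable f)
    (hinj : Function.Injective f) [IsProbabilityMeasure G₀] [NullSingletonClass G₀] (hθ : 0 < θ)
    {B : Set S} (hB0 : 0 < G₀.real B) (k : ℕ) :
    Tendsto (fun m => ∑ w, ENNReal.ofReal (∏ i ∈ Finset.range (k + 1),
        (θ * G₀.real (B ∩ label f m ⁻¹' {w}) + i) / (θ * G₀.real B + i))) atTop
      (𝓝 (ENNReal.ofReal (∏ i ∈ Finset.range k, (1 + i) / (θ * G₀.real B + 1 + i)))) := by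
  set b := θ * G₀.real B with hb
  have hbpos : 0 < b := mul_pos hθ hB0
  -- The product with the cell mass removed from its factor `i = 0`; the remaining factors are
  -- reindexed by `i + 1`.
  let Ψ : ℝ≥0∞ → ℝ≥0∞ := fun y => ENNReal.ofReal (θ / b * ∏ i ∈ Finset.range k,
    ((θ * y.toReal + (i + 1)) / (b + (i + 1)) : ℝ))
  let ν := G₀.restrict B
  have hν : ∀ m w, ν (label f m ⁻¹' {w}) = G₀ (B ∩ label f m ⁻¹' {w}) := fun m w => by
    rw [Measure.restrict_apply (measurable_label hf m (measurableSet_singleton w)), Set.inter_comm]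
  have h1 : ∀ m w, ENNReal.ofReal (∏ i ∈ Finset.range (k + 1),
      (θ * G₀.real (B ∩ label f m ⁻¹' {w}) + i) / (b + i))
        = Ψ (ν (label f m ⁻¹' {w})) * ν (label f m ⁻¹' {w}) := by
    intro m w
    rw [hν]
    conv_rhs => rw [← ofReal_measureReal (measure_ne_top G₀ _)]
    rw [← ENNReal.ofReal_mul (by positivity), Finset.prod_range_succ']
    congr 1
    rw [ENNReal.toReal_ofReal measureReal_nonneg]
    push_cast
    rw [add_zero, add_zero]
    ring
  have h2 : ∀ m, ∑ w, ENNReal.ofReal (∏ i ∈ Finset.range (k + 1),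
      (θ * G₀.real (B ∩ label f m ⁻¹' {w}) + i) / (b + i)) = ∫⁻ s, Ψ (ν (cell f m s)) ∂ν := by
    intro m
    simp_rw [h1]
    exact (lintegral_label hf m ν fun w => Ψ (ν (label f m ⁻¹' {w}))).symm
  have h3 : ENNReal.ofReal (∏ i ∈ Finset.range k, (1 + i) / (b + 1 + i))
      = ∫⁻ s, Ψ (ν {s}) ∂ν := by
    simp only [measure_singleton, lintegral_const, Ψ, ENNReal.toReal_zero, mul_zero, zero_add]
    rw [Measure.restrict_apply_univ, ← ofReal_measureReal (measure_ne_top G₀ B),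
      ← ENNReal.ofReal_mul (by positivity)]
    congr 1
    rw [mul_right_comm, div_mul_eq_mul_div, ← hb, div_self hbpos.ne', one_mul]
    refine Finset.prod_congr rfl fun i _ => ?_
    rw [add_comm (1 : ℝ), add_assoc, add_comm (1 : ℝ)]
  simp_rw [h2]
  rw [h3]
  have hν1 : ∀ A, (ν A).toReal ≤ 1 := fun A => by
    rw [← ENNReal.toReal_one]
    exact ENNReal.toReal_mono ENNReal.one_ne_top
      ((Measure.restrict_apply_le _ _).trans prob_le_one)
  -- `Ψ` increases with the mass, and masses are at most `1`.
  refine tendsto_lintegral_of_dominated_convergence (fun _ => Ψ 1) (fun m => ?_)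
    (fun m => ae_of_all _ fun s => ?_) ?_ (ae_of_all _ fun s => ?_)
  · exact (measurable_of_finite fun w => Ψ (ν (label f m ⁻¹' {w}))).comp (measurable_label hf m)
  · refine ENNReal.ofReal_le_ofReal (mul_le_mul_of_nonneg_left ?_ (by positivity))
    refine Finset.prod_le_prod (fun i _ => by positivity) fun i _ => ?_
    have := hν1 (cell f m s)
    rw [ENNReal.toReal_one]
    gcongr
  · rw [lintegral_const]
    exact ENNReal.mul_ne_top ENNReal.ofReal_ne_top (measure_ne_top _ _)
  · have hreal : Tendsto (fun m => (ν (cell f m s)).toReal) atTop (𝓝 (ν {s}).toReal) :=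
      (ENNReal.tendsto_toReal (measure_ne_top _ _)).comp (tendsto_measure_cell hf hinj ν s)
    refine ENNReal.tendsto_ofReal (Tendsto.const_mul _ (tendsto_finsetProd _ fun i _ => ?_))
    exact ((hreal.const_mul θ).add_const _).div_const _

/-- The moments of the mass that a normalized restriction of a Dirichlet process gives to a point
drawn from it. -/
theorem IsDirichletProcess.lintegral_atom_pow [MeasurableSpace.CountablySeparated S]
    [IsProbabilityMeasure μ] [IsProbabilityMeasure G₀] [NullSingletonClass G₀]
    (hP : IsDirichletProcess μ P θ G₀) (hθ : 0 < θ) {B : Set S} (hB : MeasurableSet B)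
    (hB0 : 0 < G₀.real B) (k : ℕ) :
    ∫⁻ ω, ∫⁻ s, ProbabilityTheory.cond (P ω) B {s} ^ k ∂ProbabilityTheory.cond (P ω) B ∂μ
      = ENNReal.ofReal (∏ i ∈ Finset.range k, (1 + i) / (θ * G₀.real B + 1 + i)) := by
  have := hP.isProbabilityMeasure
  obtain ⟨f, hf, hinj⟩ := MeasurableSpace.measurable_injection_nat_bool_of_countablySeparated S
  -- The mean of `∑ P_j(C) ^ (k + 1)` has two limits: the explicit product, and, by dominated
  -- convergence in `ω`, the moment sought.
  refine tendsto_nhds_unique ?_ (tendsto_sum_rising hf hinj hθ hB0 k)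
  have hmeas : ∀ m w, Measurable fun ω =>
      ProbabilityTheory.cond (P ω) B (label f m ⁻¹' {w}) ^ (k + 1) := fun m w =>
    ((Measure.measurable_coe (measurable_label hf m (measurableSet_singleton w))).comp
      (measurable_cond hP.measurable hB)).pow_const _
  have h1 : ∀ m w, ENNReal.ofReal (∏ i ∈ Finset.range (k + 1),
        (θ * G₀.real (B ∩ label f m ⁻¹' {w}) + i) / (θ * G₀.real B + i))
      = ∫⁻ ω, ProbabilityTheory.cond (P ω) B (label f m ⁻¹' {w}) ^ (k + 1) ∂μ := by
    intro m w
    rw [← hP.lintegral_ratio_pow hθ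
      (hB.inter (measurable_label hf m (measurableSet_singleton w))) hB Set.inter_subset_left hB0
      k.succ_pos]
    refine lintegral_congr fun ω => ?_
    rw [ENNReal.ofReal_pow (by positivity), ← ofReal_measureReal (measure_ne_top _ _),
      cond_real_eq_div hB]
  simp_rw [h1]
  simp_rw [← lintegral_finsetSum _ fun w _ => hmeas _ w]
  refine tendsto_lintegral_of_dominated_convergence (fun _ => 1)
    (fun m => Finset.measurable_fun_sum _ fun w _ => hmeas m w)
    (fun m => ae_of_all _ fun ω => ?_) (by simp)
    (ae_of_all _ fun ω => lintegral_atom_pow_eq_lim hf hinj _ k)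
  have := lintegral_label hf m (ProbabilityTheory.cond (P ω) B)
    fun w => ProbabilityTheory.cond (P ω) B (label f m ⁻¹' {w}) ^ k
  simp_rw [pow_succ]
  rw [← this]
  calc _ ≤ ∫⁻ s, 1 ∂ProbabilityTheory.cond (P ω) B :=
        lintegral_mono fun s => pow_le_one' prob_le_one k
    _ ≤ 1 := by rw [lintegral_one]; exact prob_le_one

end Moments

/-! ### The frequency of a symbol in a sample with a given sketch -/

section Sampling

variable {S : Type*} [MeasurableSpace S] {J : ℕ} {g : S → Fin J}

theorem measurableSet_bucket (hg : Measurable g) (j : Fin J) : MeasurableSet (bucket g j) :=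
  hg (measurableSet_singleton j)

theorem measurable_sketch (hg : Measurable g) (n : ℕ) :
    Measurable fun x : Fin n → S => sketch g x := by
  refine measurable_pi_lambda _ fun j => ?_
  simp only [sketch, Finset.card_filter]
  exact Finset.measurable_fun_sum _ fun i _ =>
    Measurable.ite ((hg.comp (measurable_pi_apply i)) (measurableSet_singleton j))
      measurable_const measurable_const

theorem measurable_freq [MeasurableEq S] (n : ℕ) :
    Measurable fun q : S × (Fin n → S) => freq q.2 q.1 := by
  simp only [freq, Finset.card_filter]
  exact Finset.measurable_fun_sum _ fun i _ =>
    Measurable.ite (measurableSet_eq_fun ((measurable_pi_apply i).comp measurable_snd)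
      measurable_fst) measurable_const measurable_const

/-- The event that the sample points are hashed to the buckets `σ`. -/
def hashEvent {n : ℕ} (g : S → Fin J) (σ : Fin n → Fin J) : Set (Fin n → S) :=
  {x | ∀ i, g (x i) = σ i}

theorem measurableSet_hashEvent (hg : Measurable g) {n : ℕ} (σ : Fin n → Fin J) :
    MeasurableSet (hashEvent g σ) :=
  MeasurableSet.congr (MeasurableSet.univ_pi fun i => measurableSet_bucket hg (σ i)) (by
    ext x; simp [hashEvent, bucket, Set.mem_pi])

/-- The positions that are hashed to bucket `j`. -/
def positions {n : ℕ} (σ : Fin n → Fin J) (j : Fin J) : Finset (Fin n) :=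
  Finset.univ.filter fun i => σ i = j

theorem pi_real_univ_pi (p : Measure S) [IsProbabilityMeasure p] {n : ℕ} (B : Fin n → Set S) :
    (Measure.pi fun _ : Fin n => p).real (Set.univ.pi B) = ∏ i, p.real (B i) := by
  rw [measureReal_def, Measure.pi_pi, ENNReal.toReal_prod]
  rfl

theorem pi_real_hashEvent (p : Measure S) [IsProbabilityMeasure p] {n : ℕ}
    (σ : Fin n → Fin J) :
    (Measure.pi fun _ : Fin n => p).real (hashEvent g σ) = ∏ i, p.real (bucket g (σ i)) := by
  rw [← pi_real_univ_pi]
  congr 1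
  ext x
  simp [hashEvent, bucket, Set.mem_pi]

/-- The event is a box: positions in `T` must equal `s`, other positions of bucket `j` must lie in
the bucket but avoid `s`, and the rest are only constrained by their buckets. -/
theorem pi_real_hashEvent_inter [MeasurableSingletonClass S]
    (p : Measure S) [IsProbabilityMeasure p] {n : ℕ} (σ : Fin n → Fin J) {j : Fin J}
    (hj : p.real (bucket g j) ≠ 0) {s : S} (hs : g s = j) {T : Finset (Fin n)}
    (hT : T ⊆ positions σ j) :
    (Measure.pi fun _ : Fin n => p).real (hashEvent g σ ∩ {x | ∀ i, x i = s ↔ i ∈ T})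
      = (p.real {s} / p.real (bucket g j)) ^ T.card
        * (1 - p.real {s} / p.real (bucket g j)) ^ ((positions σ j).card - T.card)
        * (Measure.pi fun _ : Fin n => p).real (hashEvent g σ) := by
  classical
  set v := p.real {s} / p.real (bucket g j) with hv
  let B : Fin n → Set S := fun i => if i ∈ T then {s} else
    if i ∈ positions σ j then bucket g j \ {s} else bucket g (σ i)
  have hset : hashEvent g σ ∩ {x | ∀ i, x i = s ↔ i ∈ T} = Set.univ.pi B := by
    ext x
    simp only [Set.mem_inter_iff, hashEvent, Set.mem_ofPred_eq, Set.mem_univ_pi, ← forall_and]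
    refine forall_congr' fun i => ?_
    by_cases hi : i ∈ T
    · have : σ i = j := by simpa [positions] using hT hi
      simp only [B, hi, if_true, iff_true, this, Set.mem_singleton_iff]
      exact ⟨fun h => h.2, fun h => ⟨h ▸ hs, h⟩⟩
    · by_cases hi' : σ i = j
      · simp [B, hi, positions, hi', bucket]
      -- A point hashed to another bucket differs from `s` automatically, since `g s = j`.
      · simp only [B, hi, positions, hi', bucket, Finset.mem_filter, Finset.mem_univ, true_and,
          if_false, Set.mem_preimage, Set.mem_singleton_iff, iff_false]
        exact ⟨fun h => h.1, fun h => ⟨h, fun h' => hi' (by rw [← h, h', hs])⟩⟩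
  have hB : ∀ i, p.real (B i) = (if i ∈ T then v else 1)
      * (if i ∈ positions σ j \ T then 1 - v else 1) * p.real (bucket g (σ i)) := by
    intro i
    by_cases hi : i ∈ T
    · have : σ i = j := by simpa [positions] using hT hi
      simp [B, hi, this, hv, hj]
    · by_cases hi' : i ∈ positions σ j
      · have h1 : σ i = j := by simpa [positions] using hi'
        have h2 : ({s} : Set S) ⊆ bucket g j := by simpa [bucket] using hs
        simp only [B, hi, hi', Finset.mem_sdiff, h1, if_true, if_false, not_false_eq_true,
          and_self, one_mul]
        rw [measureReal_sdiff h2 (measurableSet_singleton s), sub_mul, hv, div_mul_cancel₀ _ hj,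
          one_mul]
      · simp [B, hi, hi']
  rw [hset, pi_real_univ_pi, pi_real_hashEvent]
  simp_rw [hB]
  rw [Finset.prod_mul_distrib, Finset.prod_mul_distrib, Finset.prod_ite_mem, Finset.prod_ite_mem,
    Finset.univ_inter, Finset.univ_inter, Finset.prod_const, Finset.prod_const,
    Finset.card_sdiff_of_subset hT]

/-- The event splits according to the set `T` of positions equal to `s`. These are the `r`-subsets
of the positions of bucket `j`, all with the same probability. -/
theorem pi_real_hashEvent_freq [MeasurableEq S] (hg : Measurable g)
    (p : Measure S) [IsProbabilityMeasure p] {n : ℕ} (σ : Fin n → Fin J) {j : Fin J}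
    (hj : p.real (bucket g j) ≠ 0) {s : S} (hs : g s = j) (r : ℕ) :
    (Measure.pi fun _ : Fin n => p).real (hashEvent g σ ∩ {x | freq x s = r})
      = ((positions σ j).card.choose r : ℝ) * (p.real {s} / p.real (bucket g j)) ^ r
        * (1 - p.real {s} / p.real (bucket g j)) ^ ((positions σ j).card - r)
        * (Measure.pi fun _ : Fin n => p).real (hashEvent g σ) := by
  classical
  have hset : hashEvent g σ ∩ {x | freq x s = r} =
      ⋃ T ∈ (positions σ j).powersetCard r, hashEvent g σ ∩ {x | ∀ i, x i = s ↔ i ∈ T} := by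
    ext x
    simp only [Set.mem_iUnion, Set.mem_inter_iff, Set.mem_ofPred_eq, exists_prop,
      Finset.mem_powersetCard]
    constructor
    · rintro ⟨hx, hr⟩
      refine ⟨Finset.univ.filter fun i => x i = s, ⟨fun i hi => ?_, ?_⟩, hx, fun i => by simp⟩
      · simp only [Finset.mem_filter, Finset.mem_univ, true_and] at hi
        simp [positions, ← hx i, hi, hs]
      · rw [← hr, freq]
    · rintro ⟨T, ⟨-, hr⟩, hx, hT⟩
      refine ⟨hx, ?_⟩
      rw [freq, ← hr]
      congr 1
      ext i
      simp [hT i]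
  have hm : ∀ T : Finset (Fin n), MeasurableSet (hashEvent g σ ∩ {x | ∀ i, x i = s ↔ i ∈ T}) := by
    intro T
    refine (measurableSet_hashEvent hg σ).inter ?_
    rw [Set.ofPred_forall]
    refine MeasurableSet.iInter fun i => ?_
    by_cases hi : i ∈ T
    · simp only [hi, iff_true]
      exact measurable_pi_apply (X := fun _ : Fin n => S) i (measurableSet_singleton s)
    · simp only [hi, iff_false]
      exact (measurable_pi_apply (X := fun _ : Fin n => S) i (measurableSet_singleton s)).compl
  rw [hset, measureReal_biUnion_finset _ fun T _ => hm T]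
  · rw [Finset.sum_congr rfl fun T hT => by
      rw [pi_real_hashEvent_inter p σ hj hs (Finset.mem_powersetCard.1 hT).1,
        (Finset.mem_powersetCard.1 hT).2]]
    rw [Finset.sum_const, Finset.card_powersetCard, nsmul_eq_mul]
    ring
  · intro T _ T' _ hne
    refine Set.disjoint_left.2 fun x hx hx' => hne ?_
    ext i
    rw [← hx.2 i, ← hx'.2 i]

/-- The assignments of `n` positions to buckets that have counts `c`. -/
def assignments (n : ℕ) (c : Fin J → ℕ) : Finset (Fin n → Fin J) :=
  Finset.univ.filter fun σ => ∀ j, (positions σ j).card = c j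

theorem assignments_nonempty {n : ℕ} {c : Fin J → ℕ} (hc : ∑ i, c i = n) :
    (assignments n c).Nonempty := by
  subst hc
  -- Cut the `n` positions into consecutive blocks of lengths `c j` and send each position to its
  -- block.
  refine ⟨fun i => (finSigmaFinEquiv.symm i).1, ?_⟩
  simp only [assignments, Finset.mem_filter, Finset.mem_univ, true_and]
  intro j
  rw [← Fintype.card_fin (c j), ← Finset.card_univ]
  refine (Finset.card_bij (fun k _ => finSigmaFinEquiv ⟨j, k⟩) (fun k _ => ?_)
    (fun k _ k' _ h => ?_) fun i hi => ?_).symm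
  · simp [positions]
  · simpa using h
  · simp only [positions, Finset.mem_filter, Finset.mem_univ, true_and] at hi
    subst hi
    exact ⟨(finSigmaFinEquiv.symm i).2, Finset.mem_univ _, by simp⟩

theorem sketch_eq_iff {S : Type*} {g : S → Fin J} {n : ℕ} {c : Fin J → ℕ} (x : Fin n → S) :
    sketch g x = c ↔ ∃ σ ∈ assignments n c, x ∈ hashEvent g σ := by
  constructor
  · rintro rfl
    exact ⟨fun i => g (x i), Finset.mem_filter.2 ⟨Finset.mem_univ _, fun j => rfl⟩, fun i => rfl⟩
  · rintro ⟨σ, hσ, hx⟩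
    simp only [assignments, Finset.mem_filter, Finset.mem_univ, true_and] at hσ
    funext j
    rw [← hσ j, sketch, positions]
    simp only [show ∀ i, g (x i) = σ i from hx]

theorem measureReal_sketch_inter (hg : Measurable g) {n : ℕ} {c : Fin J → ℕ}
    (ν : Measure (Fin n → S)) [IsFiniteMeasure ν] {F : Set (Fin n → S)} (hF : MeasurableSet F) :
    ν.real ({x | sketch g x = c} ∩ F) = ∑ σ ∈ assignments n c, ν.real (hashEvent g σ ∩ F) := by
  have : {x | sketch g x = c} ∩ F = ⋃ σ ∈ assignments n c, hashEvent g σ ∩ F := by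
    ext x
    simp only [Set.mem_inter_iff, Set.mem_ofPred_eq, sketch_eq_iff, Set.mem_iUnion, exists_prop]
    tauto
  rw [this, measureReal_biUnion_finset _ fun σ _ => (measurableSet_hashEvent hg σ).inter hF]
  intro σ _ σ' _ hne
  refine Set.disjoint_left.2 fun x hx hx' => hne (funext fun i => ?_)
  rw [← hx.1 i, ← hx'.1 i]

theorem pi_real_sketch_pos (hg : Measurable g) (p : Measure S) [IsProbabilityMeasure p]
    (hp : ∀ j, p.real (bucket g j) ≠ 0) {n : ℕ} {c : Fin J → ℕ} (hc : ∑ i, c i = n) :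
    0 < (Measure.pi fun _ : Fin n => p).real {x | sketch g x = c} := by
  rw [← Set.inter_univ {x | sketch g x = c}, measureReal_sketch_inter hg _ MeasurableSet.univ]
  refine Finset.sum_pos (fun σ _ => ?_) (assignments_nonempty hc)
  rw [Set.inter_univ, pi_real_hashEvent]
  exact Finset.prod_pos fun i _ => measureReal_nonneg.lt_of_ne' (hp _)

/-- Given the sketch, the frequency of a symbol of bucket `j` is Binomial. -/
theorem pi_real_sketch_freq [MeasurableEq S] (hg : Measurable g)
    (p : Measure S) [IsProbabilityMeasure p] {n : ℕ} (c : Fin J → ℕ) {j : Fin J}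
    (hj : p.real (bucket g j) ≠ 0) {s : S} (hs : g s = j) (r : ℕ) :
    (Measure.pi fun _ : Fin n => p).real ({x | sketch g x = c} ∩ {x | freq x s = r})
      = ((c j).choose r : ℝ) * (p.real {s} / p.real (bucket g j)) ^ r
        * (1 - p.real {s} / p.real (bucket g j)) ^ (c j - r)
        * (Measure.pi fun _ : Fin n => p).real {x | sketch g x = c} := by
  have hF : MeasurableSet {x : Fin n → S | freq x s = r} :=
    ((measurable_freq n).comp (measurable_prodMk_left (x := s))) (measurableSet_singleton r)
  rw [measureReal_sketch_inter hg _ hF]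
  conv_rhs => rw [← Set.inter_univ {x | sketch g x = c},
    measureReal_sketch_inter hg _ MeasurableSet.univ]
  rw [Finset.mul_sum]
  -- The Binomial factor depends on `σ` only through the number of positions of bucket `j`, which is
  -- `c j` for every assignment.
  refine Finset.sum_congr rfl fun σ hσ => ?_
  simp only [assignments, Finset.mem_filter, Finset.mem_univ, true_and] at hσ
  rw [pi_real_hashEvent_freq hg p σ hj hs, hσ j, Set.inter_univ]

/-! ### The frequency given the sketch and the bucket of the new symbol -/

theorem integral_bucketLaw (g : S → Fin J) (j : Fin J) (p : Measure S) (f : S → ℝ) :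
    ∫ s, f s ∂bucketLaw g j p = (p.real (bucket g j))⁻¹ * ∫ s in bucket g j, f s ∂p := by
  rw [bucketLaw, ProbabilityTheory.cond, integral_smul_measure, ENNReal.toReal_inv, smul_eq_mul]
  rfl

/-- Split off the last coordinate and apply Fubini. For each `s` in the bucket the section has
Binomial probability times the sketch probability `D`, which cancels against the conditioning event.
-/
theorem freqProb_eq_integral [MeasurableEq S] (hg : Measurable g)
    (p : Measure S) [IsProbabilityMeasure p] (hp : ∀ j, p.real (bucket g j) ≠ 0) {n : ℕ}
    {c : Fin J → ℕ} (hc : ∑ i, c i = n) (j : Fin J) (r : ℕ) :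
    freqProb g n c j r p = ∫ s, ((c j).choose r : ℝ) * (bucketLaw g j p).real {s} ^ r
      * (1 - (bucketLaw g j p).real {s}) ^ (c j - r) ∂bucketLaw g j p := by
  have he : MeasurePreserving (MeasurableEquiv.piFinSuccAbove (fun _ => S) (Fin.last n))
      (Measure.pi fun _ : Fin (n + 1) => p) (p.prod (Measure.pi fun _ : Fin n => p)) :=
    measurePreserving_piFinSuccAbove (fun _ : Fin (n + 1) => p) (Fin.last n)
  have hms := measurable_sketch hg n (measurableSet_singleton c)
  have hmb := measurableSet_bucket hg j
  set D := (Measure.pi fun _ : Fin n => p).real {x | sketch g x = c} with hD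
  have hD0 : D ≠ 0 := (pi_real_sketch_pos hg p hp hc).ne'
  have hE : {x : Fin (n + 1) → S | sketch g (Fin.init x) = c ∧ g (x (Fin.last n)) = j}
      = MeasurableEquiv.piFinSuccAbove (fun _ => S) (Fin.last n) ⁻¹'
        (bucket g j ×ˢ {x | sketch g x = c}) := by
    ext x
    simp [bucket, and_comm]
  have hEF : {x : Fin (n + 1) → S | sketch g (Fin.init x) = c ∧ g (x (Fin.last n)) = j}
        ∩ {x | freq (Fin.init x) (x (Fin.last n)) = r}
      = MeasurableEquiv.piFinSuccAbove (fun _ => S) (Fin.last n) ⁻¹'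
        (bucket g j ×ˢ {x | sketch g x = c} ∩ {q | freq q.2 q.1 = r}) := by
    ext x
    simp [bucket, and_comm]
  have hmE : MeasurableSet (bucket g j ×ˢ {x : Fin n → S | sketch g x = c}) := hmb.prod hms
  have hmEF : MeasurableSet
      (bucket g j ×ˢ {x : Fin n → S | sketch g x = c} ∩ {q | freq q.2 q.1 = r}) :=
    hmE.inter (measurable_freq n (measurableSet_singleton r))
  rw [freqProb, condSample, cond_real_eq_div (by
    rw [hE]; exact (MeasurableEquiv.measurable _) hmE), hEF, hE,
    he.measureReal_preimage hmE.nullMeasurableSet, he.measureReal_preimage hmEF.nullMeasurableSet,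
    measureReal_prod_prod, ← hD, integral_bucketLaw]
  have hsec : ∀ s ∈ bucket g j, (Measure.pi fun _ : Fin n => p).real (Prod.mk s ⁻¹'
      (bucket g j ×ˢ {x | sketch g x = c} ∩ {q | freq q.2 q.1 = r}))
      = ((c j).choose r : ℝ) * (bucketLaw g j p).real {s} ^ r
      * (1 - (bucketLaw g j p).real {s}) ^ (c j - r) * D := by
    intro s hs
    have h1 : (bucketLaw g j p).real {s} = p.real {s} / p.real (bucket g j) := by
      rw [bucketLaw, cond_real_eq_div hmb, Set.inter_eq_right.2 (Set.singleton_subset_iff.2 hs)]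
    rw [h1, hD, ← pi_real_sketch_freq hg p c (hp j) hs r]
    congr 1
    ext x
    simp [hs]
  have hint : (p.prod (Measure.pi fun _ : Fin n => p)).real
      (bucket g j ×ˢ {x | sketch g x = c} ∩ {q | freq q.2 q.1 = r})
      = ∫ s in bucket g j, (Measure.pi fun _ : Fin n => p).real (Prod.mk s ⁻¹'
      (bucket g j ×ˢ {x | sketch g x = c} ∩ {q | freq q.2 q.1 = r})) ∂p := by
    rw [setIntegral_eq_integral_of_forall_compl_eq_zero fun s hs => ?_]
    · rw [measureReal_def, Measure.prod_apply hmEF, ← integral_toReal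
        (measurable_measure_prodMk_left hmEF).aemeasurable
        (ae_of_all _ fun s => measure_lt_top _ _)]
      rfl
    · rw [← measureReal_empty (μ := Measure.pi fun _ : Fin n => p)]
      congr 1
      ext x
      simp [hs]
  rw [hint, setIntegral_congr_fun hmb hsec, integral_mul_const]
  have := hp j
  field_simp

/-- The conditional mean of the frequency, as a sum over its values. -/
theorem freqMean_eq_sum [MeasurableEq S] (g : S → Fin J) (n : ℕ) (c : Fin J → ℕ) (j : Fin J)
    (p : Measure S) :
    freqMean g n c j p = ∑ r ∈ Finset.range (n + 1), (r : ℝ) * freqProb g n c j r p := by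
  have hm : ∀ r, MeasurableSet
      {x : Fin (n + 1) → S | freq (Fin.init x) (x (Fin.last n)) = r} := fun r =>
    ((measurable_freq n).comp (((measurable_pi_apply (Fin.last n))).prodMk
      (measurable_pi_lambda _ fun i => measurable_pi_apply (Fin.castSucc i))))
      (measurableSet_singleton r)
  have hle : ∀ x : Fin (n + 1) → S, freq (Fin.init x) (x (Fin.last n)) < n + 1 := fun x => by
    classical
    exact Nat.lt_succ_of_le ((Finset.card_filter_le _ _).trans (by simp))
  have hdec : ∀ x : Fin (n + 1) → S, (freq (Fin.init x) (x (Fin.last n)) : ℝ)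
      = ∑ r ∈ Finset.range (n + 1),
        {x : Fin (n + 1) → S | freq (Fin.init x) (x (Fin.last n)) = r}.indicator
          (fun _ => (r : ℝ)) x := by
    intro x
    rw [Finset.sum_eq_single_of_mem _ (Finset.mem_range.2 (hle x))]
    · simp
    · intro r _ hr
      simp [Ne.symm hr]
  have hfin : IsFiniteMeasure (condSample g n c j p) := by
    unfold condSample; infer_instance
  rw [freqMean]
  simp_rw [hdec]
  rw [integral_finsetSum _ fun r _ => (integrable_const _).indicator (hm r)]
  refine Finset.sum_congr rfl fun r _ => ?_
  rw [integral_indicator_const _ (hm r), smul_eq_mul, mul_comm, freqProb]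

end Sampling

/-! ### The mixing law -/

section Mixing

variable {Ω S : Type*} [MeasurableSpace Ω] [MeasurableSpace S] {μ : Measure Ω}
  {P : Ω → Measure S} {θ : ℝ} {G₀ : Measure S} {J : ℕ} {g : S → Fin J}

/-- The singleton is a section of the measurable diagonal, with `κ` regarded as a kernel from `Ω ×
S`; this yields joint measurability. -/
theorem measurable_kernel_real_singleton [MeasurableEq S] (κ : Kernel Ω S) [IsFiniteKernel κ] :
    Measurable fun q : Ω × S => (κ q.1).real {q.2} := by
  have hD : MeasurableSet {q : (Ω × S) × S | q.2 = q.1.2} :=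
    measurableSet_eq_fun measurable_snd (measurable_snd.comp measurable_fst)
  exact (Kernel.measurable_kernel_prodMk_left (κ := κ.comap Prod.fst measurable_fst)
    hD).ennreal_toReal

theorem measurable_measureReal_singleton [MeasurableEq S] (κ : Kernel Ω S) [IsFiniteKernel κ]
    (ω : Ω) : Measurable fun s => (κ ω).real {s} :=
  (measurable_kernel_real_singleton κ).comp measurable_prodMk_left

/-- The law of the mass that `κ ω` gives to a point drawn from it. -/
noncomputable def atomKernel [MeasurableEq S] (κ : Kernel Ω S) [IsFiniteKernel κ] :
    Kernel Ω ℝ where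
  toFun ω := (κ ω).map fun s => (κ ω).real {s}
  measurable' := by
    refine Measure.measurable_of_measurable_coe _ fun B hB => ?_
    have : (fun ω => (κ ω).map (fun s => (κ ω).real {s}) B)
        = fun ω => κ ω (Prod.mk ω ⁻¹' ((fun q : Ω × S => (κ q.1).real {q.2}) ⁻¹' B)) :=
      funext fun ω => Measure.map_apply (measurable_measureReal_singleton κ ω) hB
    rw [this]
    exact Kernel.measurable_kernel_prodMk_left (measurable_kernel_real_singleton κ hB)

theorem atomKernel_apply [MeasurableEq S] (κ : Kernel Ω S) [IsFiniteKernel κ] (ω : Ω) :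
    atomKernel κ ω = (κ ω).map fun s => (κ ω).real {s} := rfl

instance [MeasurableEq S] (κ : Kernel Ω S) [IsFiniteKernel κ] :
    IsFiniteKernel (atomKernel κ) :=
  ⟨κ.bound, κ.bound_lt_top, fun ω => by
    rw [atomKernel_apply, Measure.map_apply (measurable_measureReal_singleton κ ω)
      MeasurableSet.univ]
    exact κ.measure_le_bound ω _⟩

/-- The random law `P_j` as a kernel. -/
noncomputable def bucketKernel (hP : Measurable P) (hg : Measurable g) (j : Fin J) :
    Kernel Ω S :=
  ⟨fun ω => bucketLaw g j (P ω), measurable_cond hP (measurableSet_bucket hg j)⟩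

theorem bucketKernel_apply (hP : Measurable P) (hg : Measurable g) (j : Fin J) (ω : Ω) :
    bucketKernel hP hg j ω = bucketLaw g j (P ω) := rfl

instance (p : Measure S) (j : Fin J) : IsZeroOrProbabilityMeasure (bucketLaw g j p) :=
  inferInstanceAs (IsZeroOrProbabilityMeasure (ProbabilityTheory.cond p (bucket g j)))

instance (hP : Measurable P) (hg : Measurable g) (j : Fin J) :
    IsFiniteKernel (bucketKernel hP hg j) :=
  ⟨1, ENNReal.one_lt_top, fun ω => by rw [bucketKernel_apply]; exact prob_le_one⟩

theorem mixingLaw_eq_comp [MeasurableEq S] (hP : Measurable P) (hg : Measurable g) (j : Fin J) :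
    mixingLaw μ P g j = atomKernel (bucketKernel hP hg j) ∘ₘ μ := by
  rw [mixingLaw]
  refine congrArg μ.bind (funext fun ω => ?_)
  rw [atomKernel_apply, bucketKernel_apply]

theorem measurable_bucketLaw_singleton [MeasurableEq S] (hP : Measurable P) (hg : Measurable g)
    (j : Fin J) (ω : Ω) : Measurable fun s => (bucketLaw g j (P ω)).real {s} :=
  measurable_measureReal_singleton (bucketKernel hP hg j) ω

theorem mixingLaw_ae_mem_Icc [MeasurableEq S] (hP : Measurable P) (hg : Measurable g)
    (j : Fin J) : ∀ᵐ v ∂mixingLaw μ P g j, v ∈ Set.Icc (0 : ℝ) 1 := by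
  rw [mixingLaw_eq_comp hP hg]
  refine (Measure.ae_comp_iff (p := fun v => v ∈ Set.Icc (0 : ℝ) 1) measurableSet_Icc).2 ?_
  refine ae_of_all _ fun ω => ?_
  rw [atomKernel_apply, bucketKernel_apply]
  refine (ae_map_iff (p := fun v => v ∈ Set.Icc (0 : ℝ) 1)
    (measurable_bucketLaw_singleton hP hg j ω).aemeasurable measurableSet_Icc).2 ?_
  exact ae_of_all _ fun s => ⟨measureReal_nonneg, measureReal_le_one⟩

/-- Integrals against the mixing law, as averages of integrals against `P_j`. -/
theorem integral_mixingLaw [MeasurableEq S] [IsFiniteMeasure μ] (hP : Measurable P)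
    (hg : Measurable g) (j : Fin J) {F : ℝ → ℝ} (hF : Continuous F) :
    Integrable (fun ω => ∫ s, F ((bucketLaw g j (P ω)).real {s}) ∂bucketLaw g j (P ω)) μ ∧
      ∫ ω, ∫ s, F ((bucketLaw g j (P ω)).real {s}) ∂bucketLaw g j (P ω) ∂μ
        = ∫ v, F v ∂mixingLaw μ P g j := by
  have heq : ∀ ω, ∫ s, F ((bucketLaw g j (P ω)).real {s}) ∂bucketLaw g j (P ω)
      = ∫ v, F v ∂atomKernel (bucketKernel hP hg j) ω := fun ω => by
    rw [atomKernel_apply, bucketKernel_apply, integral_map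
      (measurable_bucketLaw_singleton hP hg j ω).aemeasurable hF.aestronglyMeasurable]
  have hfin : IsFiniteMeasure (mixingLaw μ P g j) := by
    rw [mixingLaw_eq_comp hP hg]; infer_instance
  have hint : Integrable F (mixingLaw μ P g j) :=
    integrable_of_continuous_of_ae_mem_Icc (mixingLaw_ae_mem_Icc hP hg j) hF
  rw [mixingLaw_eq_comp hP hg, Measure.comp_eq_comp_const_apply] at hint ⊢
  simp_rw [heq]
  refine ⟨?_, ?_⟩
  · simpa using hint.integral_comp
  · rw [Kernel.integral_comp hint, Kernel.const_apply]

theorem IsDirichletProcess.ae_forall_bucket_ne_zero [IsProbabilityMeasure μ]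
    [IsProbabilityMeasure G₀] (hP : IsDirichletProcess μ P θ G₀) (hθ : 0 < θ) (hg : Measurable g)
    (hG : ∀ j, 0 < G₀.real (bucket g j)) : ∀ᵐ ω ∂μ, ∀ j, (P ω).real (bucket g j) ≠ 0 := by
  have := hP.isProbabilityMeasure
  refine ae_all_iff.2 fun j => (hP.ae_pos hθ (measurableSet_bucket hg j) (hG j)).mono fun ω hω => ?_
  exact (measureReal_ne_zero_iff).2 hω

theorem IsDirichletProcess.integral_pow_mixingLaw [MeasurableSpace.CountablySeparated S]
    [IsProbabilityMeasure μ] [IsProbabilityMeasure G₀] [NullSingletonClass G₀]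
    (hP : IsDirichletProcess μ P θ G₀) (hθ : 0 < θ) (hg : Measurable g) {j : Fin J}
    (hG : 0 < G₀.real (bucket g j)) (k : ℕ) :
    ∫ v, v ^ k ∂mixingLaw μ P g j
      = ∏ i ∈ Finset.range k, ((1 + i) / (θ * G₀.real (bucket g j) + 1 + i) : ℝ) := by
  have := measurableEq_of_countablySeparated (S := S)
  have hprod : 0 ≤ ∏ i ∈ Finset.range k, ((1 + i) / (θ * G₀.real (bucket g j) + 1 + i) : ℝ) :=
    Finset.prod_nonneg fun i _ => by positivity
  have hmS : ∀ ω, Measurable fun s => (bucketLaw g j (P ω)).real {s} :=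
    measurable_bucketLaw_singleton hP.measurable hg j
  rw [integral_eq_lintegral_of_nonneg_ae
    ((mixingLaw_ae_mem_Icc hP.measurable hg j).mono fun v hv => pow_nonneg hv.1 k) (by fun_prop),
    mixingLaw_eq_comp hP.measurable hg, Measure.lintegral_bind (Kernel.aemeasurable _)
      (by fun_prop)]
  rw [← ENNReal.toReal_ofReal hprod,
    ← hP.lintegral_atom_pow hθ (measurableSet_bucket hg j) hG k]
  congr 1
  refine lintegral_congr fun ω => ?_
  rw [atomKernel_apply, bucketKernel_apply, lintegral_map (by fun_prop) (hmS ω)]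
  refine lintegral_congr fun s => ?_
  rw [ENNReal.ofReal_pow measureReal_nonneg, ofReal_measureReal (measure_ne_top _ _)]
  rfl

/-- The mixing variable is Beta distributed. -/
theorem IsDirichletProcess.mixingLaw_eq [MeasurableSpace.CountablySeparated S]
    [IsProbabilityMeasure μ] [IsProbabilityMeasure G₀] [NullSingletonClass G₀]
    (hP : IsDirichletProcess μ P θ G₀) (hθ : 0 < θ) (hg : Measurable g) {j : Fin J}
    (hG : 0 < G₀.real (bucket g j)) :
    mixingLaw μ P g j = betaMeasure 1 (θ * G₀.real (bucket g j)) := by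
  have := measurableEq_of_countablySeparated (S := S)
  have hb : 0 < θ * G₀.real (bucket g j) := mul_pos hθ hG
  have hmom := hP.integral_pow_mixingLaw hθ hg hG
  -- Total mass `1` is not automatic, as `P_j` is the zero measure where the bucket has `P`-mass
  -- zero. The zeroth moment supplies it.
  have hprob : IsProbabilityMeasure (mixingLaw μ P g j) := by
    refine ⟨?_⟩
    have h0 := hmom 0
    simp only [pow_zero, Finset.range_zero, Finset.prod_empty, integral_const, smul_eq_mul,
      mul_one, measureReal_def] at h0
    exact (ENNReal.toReal_eq_one_iff _).1 h0
  have := isProbabilityMeasureBeta one_pos hb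
  refine ext_of_moments (mixingLaw_ae_mem_Icc hP.measurable hg j) (betaMeasure_ae_mem_Icc _ _)
    fun k => ?_
  rw [hmom, integral_pow_betaMeasure_one hb]

/-! ### Binomial mixtures and the smoothed estimators -/

theorem betaBinomial_one {b : ℝ} (hb : 0 < b) {m r : ℕ} (hr : r ≤ m) :
    ∫ v, (m.choose r : ℝ) * v ^ r * (1 - v) ^ (m - r) ∂betaMeasure 1 b = betaBinomial m 1 b r := by
  simp_rw [mul_assoc]
  rw [integral_const_mul, integral_pow_mul_pow_betaMeasure one_pos hb, betaBinomial, mul_div_assoc,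
    Nat.cast_sub hr, add_sub_assoc]

theorem betaBinomial_one_eq_Gamma {b : ℝ} (hb : 0 < b) (m r : ℕ) :
    betaBinomial m 1 b r = (m.choose r : ℝ) * b
      * (Real.Gamma (r + 1) * Real.Gamma (b + m - r) / Real.Gamma (b + m + 1)) := by
  have h1 : (1 : ℝ) + r + (b + m - r) = b + m + 1 := by ring
  have hΓ := (Real.Gamma_pos_of_pos hb).ne'
  have hΓ' : Real.Gamma (b + m + 1) ≠ 0 := (Real.Gamma_pos_of_pos (by positivity)).ne'
  rw [betaBinomial, beta, beta, h1, add_comm (1 : ℝ) b, Real.Gamma_add_one hb.ne', Real.Gamma_one,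
    add_comm (1 : ℝ) r]
  field_simp

/-- This is the mean of a Binomial variable, taken from the Bernstein identity. The range goes up to
the sample size `n`, where the terms beyond `m` have zero binomial coefficient. -/
theorem sum_mul_binomial {m n : ℕ} (hmn : m ≤ n) (v : ℝ) :
    ∑ r ∈ Finset.range (n + 1), (r : ℝ) * ((m.choose r : ℝ) * v ^ r * (1 - v) ^ (m - r))
      = m * v := by
  rw [← Finset.sum_subset (Finset.range_subset_range.2 (Nat.succ_le_succ hmn))]
  · have h := congrArg (Polynomial.eval v) (bernsteinPolynomial.sum_smul ℝ m)
    simpa [Polynomial.eval_finsetSum, bernsteinPolynomial, nsmul_eq_mul] using h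
  · intro r _ hr
    rw [Finset.mem_range, not_lt] at hr
    rw [Nat.choose_eq_zero_of_lt hr]
    simp

/-- The smoothed probabilities are mixed Binomial. -/
theorem IsDirichletProcess.integral_freqProb [MeasurableEq S] [IsProbabilityMeasure μ]
    [IsProbabilityMeasure G₀] (hP : IsDirichletProcess μ P θ G₀) (hθ : 0 < θ) (hg : Measurable g)
    (hG : ∀ j, 0 < G₀.real (bucket g j)) {n : ℕ} {c : Fin J → ℕ} (hc : ∑ i, c i = n)
    (j : Fin J) (r : ℕ) :
    Integrable (fun ω => freqProb g n c j r (P ω)) μ ∧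
      ∫ ω, freqProb g n c j r (P ω) ∂μ
        = ∫ v, ((c j).choose r : ℝ) * v ^ r * (1 - v) ^ (c j - r) ∂mixingLaw μ P g j := by
  have := hP.isProbabilityMeasure
  have hae := (hP.ae_forall_bucket_ne_zero hθ hg hG).mono
    fun ω hω => freqProb_eq_integral hg (P ω) hω hc j r
  obtain ⟨h1, h2⟩ := integral_mixingLaw (μ := μ) hP.measurable hg j
    (F := fun v => ((c j).choose r : ℝ) * v ^ r * (1 - v) ^ (c j - r)) (by fun_prop)
  exact ⟨h1.congr (hae.mono fun _ h => h.symm), (integral_congr_ae hae).trans h2⟩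

/-- Summing over the values of the frequency inside the mixture leaves `c j` times the mean of
`V_j`, the first moment of a Beta law. -/
theorem IsDirichletProcess.integral_freqMean [MeasurableSpace.CountablySeparated S]
    [IsProbabilityMeasure μ] [IsProbabilityMeasure G₀] [NullSingletonClass G₀]
    (hP : IsDirichletProcess μ P θ G₀) (hθ : 0 < θ) (hg : Measurable g)
    (hG : ∀ j, 0 < G₀.real (bucket g j)) {n : ℕ} {c : Fin J → ℕ} (hc : ∑ i, c i = n)
    (j : Fin J) :
    Integrable (fun ω => freqMean g n c j (P ω)) μ ∧
      ∫ ω, freqMean g n c j (P ω) ∂μ = c j * (1 / (θ * G₀.real (bucket g j) + 1)) := by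
  have := measurableEq_of_countablySeparated (S := S)
  have hb : 0 < θ * G₀.real (bucket g j) := mul_pos hθ (hG j)
  have := isProbabilityMeasureBeta one_pos hb
  have hint := fun r => hP.integral_freqProb hθ hg hG hc j r
  have hcj : c j ≤ n := hc ▸ Finset.single_le_sum (fun _ _ => Nat.zero_le _) (Finset.mem_univ j)
  simp_rw [freqMean_eq_sum]
  refine ⟨integrable_finsetSum _ fun r _ => (hint r).1.const_mul _, ?_⟩
  rw [integral_finsetSum _ fun r _ => (hint r).1.const_mul _]
  simp_rw [integral_const_mul, (hint _).2, hP.mixingLaw_eq hθ hg (hG j), ← integral_const_mul]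
  rw [← integral_finsetSum _ fun r _ => integrable_of_continuous_of_ae_mem_Icc
    (betaMeasure_ae_mem_Icc _ _) (by fun_prop)]
  simp_rw [sum_mul_binomial hcj]
  have h1 := integral_pow_betaMeasure_one hb 1
  simp only [pow_one, Finset.range_one, Finset.prod_singleton, Nat.cast_zero, add_zero] at h1
  rw [integral_const_mul, h1]

end Mixing

/-! ### Strongly universal hash functions split the base measure evenly -/

theorem prod_diagonal_eq_zero {S : Type*} [MeasurableSpace S] [MeasurableEq S] (G : Measure S)
    [SFinite G] [NullSingletonClass G] : (G.prod G) {p | p.1 = p.2} = 0 := by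
  rw [Measure.prod_apply (measurableSet_eq_fun measurable_fst measurable_snd)]
  have : ∀ x : S, Prod.mk x ⁻¹' {p : S × S | p.1 = p.2} = {x} := fun x => by
    ext y; simp [eq_comm]
  simp [this]

/-- Exchanging the averages, the mean of `G₀(bucket) ^ 2` is the collision probability of two
independent draws. They are almost surely distinct as `G₀` has no atoms, so it equals `J⁻²`. -/
theorem ae_bucket_eq_inv {S U : Type*} [MeasurableSpace S] [MeasurableEq S] [MeasurableSpace U]
    {J : ℕ} {G₀ : Measure S} [IsProbabilityMeasure G₀] [NullSingletonClass G₀]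
    {Q : Measure U} [IsProbabilityMeasure Q] {h : U → S → Fin J} (hmeas : ∀ u, Measurable (h u))
    (huniv : IsStronglyUniversal Q h) (hindep : IsIndepOfDraws Q h G₀) :
    ∀ᵐ u ∂Q, ∀ j, G₀ (bucket (h u) j) = (J : ℝ≥0∞)⁻¹ := by
  have hprod : ∀ j u, (G₀.prod G₀) {p | h u p.1 = j ∧ h u p.2 = j} = G₀ (bucket (h u) j) ^ 2 := by
    intro j u
    rw [sq, ← Measure.prod_prod]
    rfl
  obtain ⟨s⟩ : Nonempty S := nonempty_of_isProbabilityMeasure G₀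
  obtain ⟨u⟩ : Nonempty U := nonempty_of_isProbabilityMeasure Q
  have hJ : (0 : ℝ) < J := by exact_mod_cast (h u s).pos
  have hsq : ∀ j, ∫⁻ u, G₀ (bucket (h u) j) ^ 2 ∂Q = ((J : ℝ≥0∞) ^ 2)⁻¹ := by
    intro j
    simp_rw [← hprod, (hindep j).2]
    calc _ = ∫⁻ _, ((J : ℝ≥0∞) ^ 2)⁻¹ ∂G₀.prod G₀ := by
          refine lintegral_congr_ae ?_
          have : ∀ᵐ p ∂G₀.prod G₀, p.1 ≠ p.2 := by
            rw [ae_iff]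
            simpa using prod_diagonal_eq_zero G₀
          filter_upwards [this] with p hp
          exact huniv.pairwise _ _ hp j j
      _ = _ := by simp
  let X : Fin J → U → ℝ := fun j u => G₀.real (bucket (h u) j)
  have hXm : ∀ j, AEMeasurable (fun u => X j u ^ 2) Q := by
    intro j
    have := (hindep j).1.ennreal_toReal
    simp_rw [hprod, ENNReal.toReal_pow] at this
    exact this
  have hX01 : ∀ j u, X j u ∈ Set.Icc (0 : ℝ) 1 :=
    fun j u => ⟨measureReal_nonneg, measureReal_le_one⟩
  have hXint : ∀ j, Integrable (fun u => X j u ^ 2) Q := fun j =>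
    Integrable.of_bound (hXm j).aestronglyMeasurable 1 (ae_of_all _ fun u => by
      rw [Real.norm_eq_abs, abs_of_nonneg (sq_nonneg _)]
      exact pow_le_one₀ (hX01 j u).1 (hX01 j u).2)
  have hXsq : ∀ j, ∫ u, X j u ^ 2 ∂Q = ((J : ℝ) ^ 2)⁻¹ := by
    intro j
    rw [integral_eq_lintegral_of_nonneg_ae (ae_of_all _ fun u => sq_nonneg _)
      (hXm j).aestronglyMeasurable]
    have : ∀ u, ENNReal.ofReal (X j u ^ 2) = G₀ (bucket (h u) j) ^ 2 := fun u => by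
      rw [ENNReal.ofReal_pow (hX01 j u).1, ofReal_measureReal (measure_ne_top _ _)]
    simp_rw [this, hsq]
    simp
  have hXsum : ∀ u, ∑ j, X j u = 1 := by
    intro u
    rw [← measureReal_biUnion_finset]
    · have : (⋃ j ∈ Finset.univ, bucket (h u) j) = Set.univ := by
        ext x; simp [bucket]
      rw [this, probReal_univ]
    · intro j _ j' _ hne
      refine Set.disjoint_left.2 fun x hx hx' => hne ?_
      exact (Set.mem_singleton_iff.1 hx).symm.trans hx'
    · exact fun j _ => measurableSet_bucket (hmeas u) j
  -- The masses sum to `1` for every `u`, so the cross term is constant and only second moments need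
  -- to be integrated.
  have hdev : ∀ u, ∑ j, (X j u - (J : ℝ)⁻¹) ^ 2 = ∑ j, X j u ^ 2 - (J : ℝ)⁻¹ := by
    intro u
    simp_rw [sub_sq, Finset.sum_add_distrib, Finset.sum_sub_distrib, ← Finset.sum_mul,
      ← Finset.mul_sum, hXsum u]
    rw [Finset.sum_const, Finset.card_univ, Fintype.card_fin, nsmul_eq_mul]
    field_simp
    ring
  -- The mean is `J * J⁻² - J⁻¹ = 0`.
  have hzero : ∫ u, ∑ j, (X j u - (J : ℝ)⁻¹) ^ 2 ∂Q = 0 := by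
    simp_rw [hdev]
    rw [integral_sub (integrable_finsetSum _ fun j _ => hXint j) (integrable_const _),
      integral_finsetSum _ fun j _ => hXint j]
    simp_rw [hXsq]
    rw [Finset.sum_const, Finset.card_univ, Fintype.card_fin, nsmul_eq_mul, integral_const,
      probReal_univ, one_smul]
    field_simp
    simp
  have hdint : Integrable (fun u => ∑ j, (X j u - (J : ℝ)⁻¹) ^ 2) Q := by
    simp_rw [hdev]
    exact (integrable_finsetSum _ fun j _ => hXint j).sub (integrable_const _)
  rw [integral_eq_zero_iff_of_nonneg (fun u => Finset.sum_nonneg fun j _ => sq_nonneg _) hdint]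
    at hzero
  filter_upwards [hzero] with u hu j
  have h0 := (Finset.sum_eq_zero_iff_of_nonneg fun j _ => sq_nonneg _).1 hu j (Finset.mem_univ j)
  have h1 : X j u = (J : ℝ)⁻¹ := sub_eq_zero.1 (pow_eq_zero_iff two_ne_zero |>.1 h0)
  rw [← ofReal_measureReal (measure_ne_top G₀ _)]
  change ENNReal.ofReal (X j u) = _
  rw [h1, ENNReal.ofReal_inv_of_pos hJ, ENNReal.ofReal_natCast]

end SmoothedSketch

open SmoothedSketch in
theorem proposition1
    {S U Ω : Type*} [MeasurableSpace S] [MeasurableSpace.CountablySeparated S]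
    [MeasurableSpace U] [MeasurableSpace Ω]
    (J : ℕ)
    -- the smoothing distribution `P ∼ DP(θ, G₀)`, with `G₀` non-atomic
    (θ : ℝ) (hθ : 0 < θ) (G₀ : Measure S) [IsProbabilityMeasure G₀] [NullSingletonClass G₀]
    (μ : Measure Ω) [IsProbabilityMeasure μ] (P : Ω → Measure S)
    (hP : IsDirichletProcess μ P θ G₀)
    -- the random hash function
    (Q : Measure U) [IsProbabilityMeasure Q] (h : U → S → Fin J) (hmeas : ∀ u, Measurable (h u))
    (huniv : IsStronglyUniversal Q h) (hindep : IsIndepOfDraws Q h G₀) :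
    -- almost every hash function splits `G₀` evenly among the buckets
    (∀ᵐ u ∂Q, ∀ j, G₀ (bucket (h u) j) = (J : ℝ≥0∞)⁻¹) ∧
    -- and for every hash function that does so, and every bucket:
    ∀ g : S → Fin J, Measurable g → (∀ j, G₀ (bucket g j) = (J : ℝ≥0∞)⁻¹) →
      ∀ j : Fin J,
        -- the mixing variable is `Beta(1, θ/J)`
        mixingLaw μ P g j = betaMeasure 1 (θ / J) ∧
        -- and for every sketch `c` of a sample of size `n`:
        ∀ (n : ℕ) (c : Fin J → ℕ), ∑ i, c i = n →
          -- `π_j(r) = E[π_j(r; P)]` is the mixed Binomial probability, and is Beta-Binomial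
          (∀ r ≤ c j,
            Integrable (fun ω => freqProb g n c j r (P ω)) μ ∧
            ∫ ω, freqProb g n c j r (P ω) ∂μ
              = ∫ v, ((c j).choose r : ℝ) * v ^ r * (1 - v) ^ (c j - r) ∂(mixingLaw μ P g j) ∧
            ∫ ω, freqProb g n c j r (P ω) ∂μ = betaBinomial (c j) 1 (θ / J) r ∧
            ∫ ω, freqProb g n c j r (P ω) ∂μ
              = ((c j).choose r : ℝ) * (θ / J)
                * (Real.Gamma (r + 1) * Real.Gamma (θ / J + c j - r)
                  / Real.Gamma (θ / J + c j + 1))) ∧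
          -- the smoothed frequency estimator `E[ε_f(P)]`
          Integrable (fun ω => freqMean g n c j (P ω)) μ ∧
          ∫ ω, freqMean g n c j (P ω) ∂μ = c j * (J / (θ + J)) := by
  have := measurableEq_of_countablySeparated (S := S)
  refine ⟨ae_bucket_eq_inv hmeas huniv hindep, fun g hg hG j => ?_⟩
  have hJ : (0 : ℝ) < J := by exact_mod_cast j.pos
  have hb : 0 < θ / J := div_pos hθ hJ
  have hGr : ∀ j, G₀.real (bucket g j) = (J : ℝ)⁻¹ := fun j => by
    rw [measureReal_def, hG, ENNReal.toReal_inv, ENNReal.toReal_natCast]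
  have hGpos : ∀ j, 0 < G₀.real (bucket g j) := fun j => by
    rw [hGr]
    exact inv_pos.2 hJ
  have hlaw : mixingLaw μ P g j = betaMeasure 1 (θ / J) := by
    rw [hP.mixingLaw_eq hθ hg (hGpos j), hGr, div_eq_mul_inv]
  refine ⟨hlaw, fun n c hc => ⟨fun r hr => ?_, ?_⟩⟩
  · obtain ⟨h1, h2⟩ := hP.integral_freqProb hθ hg hGpos hc j r
    have h3 : ∫ ω, freqProb g n c j r (P ω) ∂μ = betaBinomial (c j) 1 (θ / J) r := by
      rw [h2, hlaw, betaBinomial_one hb hr]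
    exact ⟨h1, h2, h3, h3.trans (betaBinomial_one_eq_Gamma hb _ _)⟩
  · obtain ⟨h1, h2⟩ := hP.integral_freqMean hθ hg hGpos hc j
    refine ⟨h1, ?_⟩
    rw [h2, hGr]
    have : θ + J ≠ 0 := by positivity
    field_simp
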